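/- A hypergraph $H=(V,E)$ consists of a finite vertex set $V$ and a finite multiset $E$ of subsets of $V$. The degree $\deg_M(v)$ of a vertex $v$ in $M\subseteq E$ is the number of edges in $M$ containing $v$; $\delta$ and $\Delta$ are the minimum and maximum of $\deg_E(v)$. $H$ is $r$-uniform if all edges have size $r$, regular if $\delta=\Delta$, and $\mu$-near-regular ($\mu\in\mathbb R$) if $\delta>0$ and $\Delta/\delta\le\mu$ (which forces $\mu\ge 1$). A cycle of length $k\ge 2$ consists of distinct vertices $v_1,\dots,v_k$ and distinct edges $e_1,\dots,e_k$ with $\{v_i,v_{i+1}\}\subseteq e_i$ for all $i$, where $v_{k+1}=v_1$; the girth is the smallest length of a cycle ($\infty$ if there is none). A set $M\subseteq E$ is a $t$-shallow hitting edge set if $1\le\deg_M(v)\le t$ for every $v\in V$. $W$ is (the principal branch of) the Lambert function, $W(x)e^{W(x)}=x$. $o_{\mu r}(1)$ stands for a nonnegative function $f(\mu,r)$ that tends to $0$ whenever $\mu r\to\infty$ (in whatever way $\mu$ and $r$ vary), and $o_r(1)$ for a nonnegative function of $r$ that tends to $0$ as $r\to\infty$. **Theorem.** There is an integer-valued function $t(\mu,r)$,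 defined for real $\mu\ge1$ and integers $r\ge2$, with $$t(\mu,r)=c\,\mu\ln(r)\,(1+o_{\mu r}(1))=O(\mu\ln r),\qquad c=c(\mu)=e^{1+W(2/(e\mu))}$$ (the constant in $O$ is uniform in $\mu\ge 1$, $r\ge 2$), such that for all integers $r\ge 2$ and all $\mu$, every $r$-uniform $\mu$-near-regular hypergraph of girth at least $4$ has a $t(\mu,r)$-shallow hitting edge set. Moreover $c(\mu)\to e$ as $\mu\to\infty$. **Corollary.** There is an integer-valued function $t(r)$, defined for integers $r\ge2$, with $$t(r)=c\ln(r)\,(1+o_r(1))=O(\ln r),\qquad c=e^{1+W(2/e)}=4.319\dots,$$ such that for every integer $r\ge2$, every $r$-uniform regular hypergraph with positive minimum degree and girth at least $4$ has a $t(r)$-shallow hitting edge set. -/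

import Mathlib

open Filter Topology

/-- A (finite) hypergraph on the vertex set `V` whose multiset of edges is indexed by `E`:
every `e : E` is an edge, and `H.edge e` is the set of vertices it consists of.
Parallel edges are distinct indices with the same vertex set. -/
structure MultiHypergraph (V E : Type*) where
  /-- the vertex set of an edge -/
  edge : E → Finset V

namespace MultiHypergraph

variable {V E : Type*}

open scoped Classical in
/-- The degree of `v` in the edge set `M`: the number of edges of `M` incident to `v`. -/
noncomputable def degreeIn (H : MultiHypergraph V E) (M : Finset E) (v : V) : ℕ :=
  (M.filter (fun e => v ∈ H.edge e)).card

/-- The degree of a vertex. -/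
noncomputable def degree [Fintype E] (H : MultiHypergraph V E) (v : V) : ℕ :=
  H.degreeIn Finset.univ v

/-- The largest degree of a vertex. -/
noncomputable def maxDegree [Fintype V] [Fintype E] (H : MultiHypergraph V E) : ℕ :=
  Finset.univ.sup H.degree

/-- The smallest degree of a vertex (it is `0` if there are no vertices). -/
noncomputable def minDegree [Fintype E] (H : MultiHypergraph V E) : ℕ :=
  ⨅ v, H.degree v

/-- Every edge has exactly `r` vertices. -/
def IsUniform (H : MultiHypergraph V E) (r : ℕ) : Prop :=
  ∀ e, (H.edge e).card = r

/-- Maximum and minimum degree agree. -/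
def IsRegular [Fintype V] [Fintype E] (H : MultiHypergraph V E) : Prop :=
  H.maxDegree = H.minDegree

/-- `δ > 0` and `Δ / δ ≤ μ`. -/
def IsNearRegular [Fintype V] [Fintype E] (H : MultiHypergraph V E) (μ : ℝ) : Prop :=
  0 < H.minDegree ∧ (H.maxDegree : ℝ) / (H.minDegree : ℝ) ≤ μ

/-- There is a cycle `v₁ e₁ v₂ e₂ … v_k e_k v₁` of length `k ≥ 2`: the `k` vertices are distinct,
the `k` edges are distinct, and `e_i` contains `v_i` and the cyclically next vertex. -/
def HasCycle (H : MultiHypergraph V E) (k : ℕ) : Prop :=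
  2 ≤ k ∧ ∃ (v : Fin k → V) (e : Fin k → E), Function.Injective v ∧ Function.Injective e ∧
    ∀ i, v i ∈ H.edge (e i) ∧ v (finRotate k i) ∈ H.edge (e i)

/-- The length of a shortest cycle, `⊤` if there is no cycle. -/
noncomputable def girth (H : MultiHypergraph V E) : ℕ∞ :=
  ⨅ (k : ℕ) (_ : H.HasCycle k), (k : ℕ∞)

/-- Every vertex is covered by `M`. -/
def IsHitting (H : MultiHypergraph V E) (M : Finset E) : Prop :=
  ∀ v, 1 ≤ H.degreeIn M v

/-- Every vertex is covered at most `t` times by `M`. -/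
def IsShallow (H : MultiHypergraph V E) (t : ℕ) (M : Finset E) : Prop :=
  ∀ v, H.degreeIn M v ≤ t

end MultiHypergraph

/-- The (principal branch of the) Lambert `W`-function: the inverse of `w ↦ w * exp w` on
`[-1, ∞)`, see `lambertW_spec` and `lambertW_unique`. -/
noncomputable def lambertW (x : ℝ) : ℝ :=
  Function.invFunOn (fun w : ℝ => w * Real.exp w) (Set.Ici (-1)) x

theorem lambertW_spec {x : ℝ} (hx : -Real.exp (-1) ≤ x) :
    -1 ≤ lambertW x ∧ lambertW x * Real.exp (lambertW x) = x := by
  have h : ∃ w ∈ Set.Ici (-1 : ℝ), (fun w : ℝ => w * Real.exp w) w = x := by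
    have hab : (-1 : ℝ) ≤ max x 0 := le_trans (by norm_num) (le_max_right x 0)
    have hc : ContinuousOn (fun w : ℝ => w * Real.exp w) (Set.Icc (-1) (max x 0)) := by fun_prop
    have hm : x ∈ Set.Icc ((fun w : ℝ => w * Real.exp w) (-1))
        ((fun w : ℝ => w * Real.exp w) (max x 0)) := by
      refine ⟨by simpa using hx, ?_⟩
      have h1 : 1 ≤ Real.exp (max x 0) := Real.one_le_exp (le_max_right x 0)
      have h2 : 0 ≤ max x 0 := le_max_right x 0
      have h3 : x ≤ max x 0 := le_max_left x 0
      show x ≤ max x 0 * Real.exp (max x 0)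
      nlinarith
    obtain ⟨w, hw, hwx⟩ := intermediate_value_Icc hab hc hm
    exact ⟨w, hw.1, hwx⟩
  exact ⟨Function.invFunOn_mem h, Function.invFunOn_eq h⟩

theorem mul_exp_strictMonoOn : StrictMonoOn (fun w : ℝ => w * Real.exp w) (Set.Ici (-1)) := by
  refine strictMonoOn_of_deriv_pos (convex_Ici _) (by fun_prop) ?_
  intro w hw
  rw [interior_Ici, Set.mem_Ioi] at hw
  have h : HasDerivAt (fun w : ℝ => w * Real.exp w) (1 * Real.exp w + w * Real.exp w) w :=
    (hasDerivAt_id w).mul (Real.hasDerivAt_exp w)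
  rw [h.deriv]
  have := Real.exp_pos w
  nlinarith

theorem lambertW_unique {w x : ℝ} (hw : -1 ≤ w) (h : w * Real.exp w = x) : lambertW x = w := by
  have hex : ∃ a ∈ Set.Ici (-1 : ℝ), (fun w : ℝ => w * Real.exp w) a = x := ⟨w, hw, h⟩
  exact mul_exp_strictMonoOn.injOn (Function.invFunOn_mem hex) hw
    ((Function.invFunOn_eq hex).trans h.symm)

/-- The constant `c = exp (1 + W(2 / (e μ)))`. -/
noncomputable def shallowConst (μ : ℝ) : ℝ :=
  Real.exp (1 + lambertW (2 / (Real.exp 1 * μ)))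

/-- The class `o_r(1)`: nonnegative functions `f` with `f r → 0` as `r → ∞`. -/
def IsLittleOR (f : ℕ → ℝ) : Prop :=
  (∀ r, 0 ≤ f r) ∧ Tendsto f atTop (𝓝 0)

/-- The class `o_{μr}(1)`: nonnegative functions `f` with `f μ r → 0` whenever `μ * r → ∞`
(in whatever way `μ` and `r` vary, so `r` may stay bounded while `μ → ∞`). -/
def IsLittleOMuR (f : ℝ → ℕ → ℝ) : Prop :=
  (∀ μ r, 0 ≤ f μ r) ∧
    Tendsto (fun p : ℝ × ℕ => f p.1 p.2)
      (comap (fun p : ℝ × ℕ => p.1 * (p.2 : ℝ)) atTop) (𝓝 0)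

/-! The core is `exists_uniform_cover_bound`: a hitting set of maximum degree at most `c μ log r +
C`, with one `C` for all `μ` and `r`. Taking `t = ⌈c μ log r⌉ + C` then suffices, because `c μ log
r` is at least a constant times `log (μ r)`, so the relative error vanishes whenever `μ r → ∞`. Two
different arguments cover large and bounded `r`.

Large `r` (`exists_cover_of_large`): sample edges so that every vertex has expected degree at least
`1.1 log r`, and let the local lemma exclude uncovered vertices and degrees of `c μ log r` or more.
The local lemma has to beat `log (r s)`, where `s` is the minimum degree, so `s` is first brought
down to order `log r`; then `log (r s)` is close to `log r`. As `c (log c - 1) = 2 / μ`, Chernoff's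
exponent at `c μ log r` is about `(2 + μ) log r`. The surplus absorbs every loss, and no additive
constant is needed.

Bounded `r` (`exists_cover_add_const`): now `μ` may be unbounded, and the additive error must depend
on `r` only. Beck–Fiala rounding has this property, since its error is the `ℓ¹`-norm of a column,
here controlled by the edge size. It is used to thin to minimum degree `s ≤ 41 r`, to derandomize a
sampling step that leaves a vertex uncovered with probability `1 / r` (`exists_partial_cover`), and
to cover the remaining vertices (`exists_repair`). The main term is about `1.05 μ (log r + 1.05)`,
which is below `c μ log r` already for `r = 2`. -/

/-! ### Beck–Fiala rounding -/

/-- A nonzero direction inside the floating coordinates can be followed until some floating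
coordinate becomes integral. -/
theorem exists_step_to_boundary {I : Type*} [Fintype I] {x z : I → ℝ}
    (hx : ∀ i, 0 ≤ x i ∧ x i ≤ 1) (hne : ∃ i, z i ≠ 0) :
    ∃ c : ℝ, (∀ i, 0 ≤ x i + c * z i ∧ x i + c * z i ≤ 1) ∧
      ∃ i, z i ≠ 0 ∧ (x i + c * z i = 0 ∨ x i + c * z i = 1) := by
  classical
  -- `g i` is the time at which coordinate `i` leaves the cube; the smallest such time is the step
  -- length.
  set g : I → ℝ := fun i => if 0 < z i then (1 - x i) / z i else x i / (-z i) with hg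
  obtain ⟨i₀, hi₀, hmin⟩ := Finset.exists_min_image (Finset.univ.filter fun i => z i ≠ 0) g
    (by obtain ⟨i, hi⟩ := hne; exact ⟨i, by simp [hi]⟩)
  have hi₀' : z i₀ ≠ 0 := by simpa using hi₀
  have hpos : 0 ≤ g i₀ := by
    simp only [hg]
    split_ifs with h
    · exact div_nonneg (by linarith [(hx i₀).2]) h.le
    · exact div_nonneg (hx i₀).1 (by linarith)
  refine ⟨g i₀, fun i => ?_, i₀, hi₀', ?_⟩
  · by_cases hzi : z i = 0
    · simpa [hzi] using hx i
    · have hle := hmin i (by simp [hzi])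
      rcases lt_or_gt_of_ne hzi with h | h
      · have hgi : g i = x i / (-z i) := by simp [hg, not_lt.mpr h.le]
        rw [hgi, le_div_iff₀ (by linarith)] at hle
        constructor
        · linarith
        · nlinarith [(hx i).2]
      · have hgi : g i = (1 - x i) / z i := by simp [hg, h]
        rw [hgi, le_div_iff₀ h] at hle
        constructor
        · nlinarith [(hx i).1]
        · linarith
  · rcases lt_or_gt_of_ne hi₀' with h | h
    · left
      have hgi : g i₀ = x i₀ / (-z i₀) := by simp [hg, not_lt.mpr h.le]
      rw [hgi]; field_simp; ring
    · right
      have hgi : g i₀ = (1 - x i₀) / z i₀ := by simp [hg, h]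
      rw [hgi]; field_simp; ring

open scoped Classical in
/-- Fewer than `|S|` linear conditions have a common nonzero solution supported on `S`. -/
theorem exists_ne_zero_supported {I C : Type*} [Fintype I] (S : Finset I)
    (A : Finset C) (a : C → I → ℝ) (h : A.card < S.card) :
    ∃ z : I → ℝ, (∃ i, z i ≠ 0) ∧ (∀ i, z i ≠ 0 → i ∈ S) ∧ ∀ c ∈ A, ∑ i, a c i * z i = 0 := by
  let L : (S → ℝ) →ₗ[ℝ] (A → ℝ) :=
    LinearMap.pi fun c => ∑ i : S, (a c i) • LinearMap.proj (R := ℝ) (φ := fun _ : S => ℝ) i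
  have hker : LinearMap.ker L ≠ ⊥ := LinearMap.ker_ne_bot_of_finrank_lt (by simpa using h)
  obtain ⟨u, hu, hu0⟩ := (Submodule.ne_bot_iff _).mp hker
  refine ⟨fun i => if hi : i ∈ S then u ⟨i, hi⟩ else 0, ?_, ?_, ?_⟩
  · obtain ⟨i, hi⟩ := Function.ne_iff.mp hu0
    exact ⟨i, by simpa using hi⟩
  · intro i hi
    by_contra hn
    simp [hn] at hi
  · intro c hc
    have h1 := congrFun (LinearMap.mem_ker.mp hu) ⟨c, hc⟩
    have h2 : ∑ i : S, a c i * u i = 0 := by simpa [L] using h1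
    refine Eq.trans ?_ h2
    rw [← Finset.sum_subset (Finset.subset_univ S), ← Finset.sum_coe_sort S]
    · exact Finset.sum_congr rfl fun i _ => by simp
    · intro i _ hi
      simp [hi]

open scoped Classical in
/-- **Beck–Fiala rounding.** If the columns of `a` have `ℓ¹`-norm at most `B`, then every point of
the cube can be rounded to a vertex, changing no linear form `a c` by more than `B`, and keeping
the coordinates that are already integral. -/
theorem exists_rounding {I C : Type*} [Fintype I] [Fintype C] (a : C → I → ℝ) {B : ℝ}
    (hB : 0 ≤ B) (ha : ∀ i, ∑ c, |a c i| ≤ B) (x : I → ℝ) (hx : ∀ i, 0 ≤ x i ∧ x i ≤ 1) :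
    ∃ y : I → ℝ, (∀ i, y i = 0 ∨ y i = 1) ∧ (∀ i, x i = 0 ∨ x i = 1 → y i = x i) ∧
      ∀ c, |∑ i, a c i * (y i - x i)| ≤ B := by
  induction hn : (Finset.univ.filter fun i => 0 < x i ∧ x i < 1).card using
    Nat.strong_induction_on generalizing x with
  | _ n ih =>
  set S := Finset.univ.filter fun i => 0 < x i ∧ x i < 1 with hS
  have hoff : ∀ i, i ∉ S → x i = 0 ∨ x i = 1 := by
    intro i hi
    simp only [hS, Finset.mem_filter, Finset.mem_univ, true_and, not_and, not_lt] at hi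
    rcases (hx i).1.eq_or_lt with h | h
    · exact Or.inl h.symm
    · exact Or.inr (le_antisymm (hx i).2 (hi h))
  by_cases hS0 : S = ∅
  · refine ⟨x, fun i => hoff i (by simp [hS0]), fun _ _ => rfl, fun c => by simpa using hB⟩
  -- Forms still heavy on the floating coordinates are frozen. Double counting the column norms
  -- shows that there are fewer of them than floating coordinates, so a direction preserving all of
  -- them exists.
  set A := Finset.univ.filter fun c => B < ∑ i ∈ S, |a c i| with hA
  have hcard : A.card < S.card := by
    rcases A.eq_empty_or_nonempty with h | h
    · rw [h, Finset.card_empty]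
      exact Finset.card_pos.mpr (Finset.nonempty_iff_ne_empty.mpr hS0)
    · have h1 : (A.card : ℝ) * B < ∑ c ∈ A, ∑ i ∈ S, |a c i| := by
        rw [← nsmul_eq_mul, ← Finset.sum_const]
        exact Finset.sum_lt_sum_of_nonempty h fun c hc => by simpa [hA] using hc
      have h2 : ∑ c ∈ A, ∑ i ∈ S, |a c i| ≤ (S.card : ℝ) * B := by
        rw [Finset.sum_comm, ← nsmul_eq_mul, ← Finset.sum_const]
        refine Finset.sum_le_sum fun i _ => le_trans ?_ (ha i)
        exact Finset.sum_le_sum_of_subset_of_nonneg (Finset.subset_univ _)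
          fun _ _ _ => abs_nonneg _
      exact_mod_cast lt_of_mul_lt_mul_right (h1.trans_le h2) hB
  obtain ⟨z, hzne, hzS, hzA⟩ := exists_ne_zero_supported S A a hcard
  obtain ⟨c, hc, i₀, hi₀, hi₀'⟩ := exists_step_to_boundary hx hzne
  set x' : I → ℝ := fun i => x i + c * z i with hx'
  have hxx' : ∀ i, x i = 0 ∨ x i = 1 → x' i = x i := by
    intro i hi
    have : z i = 0 := by
      by_contra h
      have := hzS i h
      simp only [hS, Finset.mem_filter] at this
      rcases hi with hi | hi <;> linarith [this.2.1, this.2.2]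
    simp [hx', this]
  obtain ⟨y, hy01, hyx', hyB⟩ := ih _ (by
    rw [← hn]
    refine Finset.card_lt_card ⟨fun i hi => ?_, fun h => ?_⟩
    · by_contra hiS
      have h1 := hoff i hiS
      have h2 := hxx' i h1
      simp only [Finset.mem_filter] at hi
      rcases h1 with h1 | h1 <;> linarith [hi.2.1, hi.2.2]
    · have := h (hzS i₀ hi₀)
      simp only [Finset.mem_filter] at this
      rcases hi₀' with h1 | h1 <;> linarith [this.2.1, this.2.2]) x' hc rfl
  have hyx : ∀ i, x i = 0 ∨ x i = 1 → y i = x i := fun i hi => by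
    rw [hyx' i (by rwa [hxx' i hi]), hxx' i hi]
  refine ⟨y, hy01, hyx, fun d => ?_⟩
  by_cases hd : d ∈ A
  · have : ∑ i, a d i * (y i - x i) = ∑ i, a d i * (y i - x' i) := by
      rw [← sub_eq_zero, ← Finset.sum_sub_distrib]
      calc ∑ i, (a d i * (y i - x i) - a d i * (y i - x' i)) = c * ∑ i, a d i * z i := by
            rw [Finset.mul_sum]; exact Finset.sum_congr rfl fun i _ => by simp only [hx']; ring
        _ = 0 := by rw [hzA d hd, mul_zero]
    rw [this]
    exact hyB d
  -- A form that is no longer frozen has weight at most `B` on the floating coordinates, each of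
  -- which moves by at most 1 in all remaining rounds together.
  · have hd' : ∑ i ∈ S, |a d i| ≤ B := by simpa [hA] using hd
    refine le_trans ?_ hd'
    rw [← Finset.sum_subset (Finset.subset_univ S) fun i _ hi => by
      rw [hyx i (hoff i hi), sub_self, mul_zero]]
    refine (Finset.abs_sum_le_sum_abs _ _).trans (Finset.sum_le_sum fun i _ => ?_)
    rw [abs_mul]
    refine mul_le_of_le_one_right (abs_nonneg _) (abs_le.mpr ?_)
    rcases hy01 i with h | h <;> rw [h] <;> constructor <;> linarith [(hx i).1, (hx i).2]

/-! ### Thinning a hypergraph by rounding -/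

namespace MultiHypergraph

open scoped Classical in
theorem degreeIn_eq_sum {V E : Type*} (H : MultiHypergraph V E) (M : Finset E) (v : V) :
    (H.degreeIn M v : ℝ) = ∑ e ∈ M, if v ∈ H.edge e then (1 : ℝ) else 0 := by
  simp [degreeIn]

open scoped Classical in
theorem IsUniform.sum_ite_mem {V E : Type*} [Fintype V] {H : MultiHypergraph V E} {r : ℕ}
    (hU : H.IsUniform r) (e : E) : ∑ v, (if v ∈ H.edge e then (1 : ℝ) else 0) = r := by
  simp [hU e]

open scoped Classical in
theorem exists_near_fraction {V E : Type*} [Fintype V] [Fintype E] {H : MultiHypergraph V E}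
    {r : ℕ} (hU : H.IsUniform r) {q : ℝ} (hq0 : 0 ≤ q) (hq1 : q ≤ 1) :
    ∃ F : Finset E, ∀ v, |(H.degreeIn F v : ℝ) - q * H.degree v| ≤ r := by
  obtain ⟨y, hy, -, hyB⟩ := exists_rounding (I := E) (C := V)
    (fun v e => if v ∈ H.edge e then (1 : ℝ) else 0) (B := r) (by positivity)
    (fun e => by
      rw [← hU.sum_ite_mem e]
      exact (Finset.sum_congr rfl fun v _ => by split_ifs <;> simp).le)
    (fun _ => q) (fun _ => ⟨hq0, hq1⟩)
  refine ⟨Finset.univ.filter fun e => y e = 1, fun v => ?_⟩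
  convert hyB v using 2
  rw [degree, degreeIn_eq_sum, degreeIn_eq_sum, Finset.sum_filter, Finset.mul_sum,
    ← Finset.sum_sub_distrib]
  refine Finset.sum_congr rfl fun e _ => ?_
  rcases hy e with h | h <;> simp [h]
  split_ifs <;> simp

/-- A near-regular hypergraph can be thinned until all degrees are at least some `s ≤ N`,
at the price of a factor `(N + r) / (N - r)` in the ratio of the degrees. -/
theorem exists_thinning {V E : Type*} [Fintype V] [Fintype E] {H : MultiHypergraph V E}
    {r : ℕ} (hU : H.IsUniform r) {μ : ℝ} (hμ : 1 ≤ μ) {δ : ℕ} (hδ : 1 ≤ δ)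
    (hlow : ∀ v, δ ≤ H.degree v) (hupp : ∀ v, (H.degree v : ℝ) ≤ μ * δ) {N : ℕ} (hN : r < N) :
    ∃ (F : Finset E) (s : ℕ), 1 ≤ s ∧ s ≤ N ∧ (∀ v, s ≤ H.degreeIn F v) ∧
      ∀ v, (H.degreeIn F v : ℝ) ≤ (N + r) / (N - r) * μ * s := by
  have hN' : (0 : ℝ) < N - r := by
    have : (r : ℝ) < N := by exact_mod_cast hN
    linarith
  have hr0 : (0 : ℝ) ≤ r := Nat.cast_nonneg r
  have hκ : (1 : ℝ) ≤ (N + r) / (N - r) := by rw [le_div_iff₀ hN']; linarith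
  rcases le_or_gt δ N with h | h
  · refine ⟨Finset.univ, δ, hδ, h, hlow, fun v => (hupp v).trans ?_⟩
    gcongr
    nlinarith
  · have hδ0 : (0 : ℝ) < δ := by exact_mod_cast hδ
    have hNδ : (N : ℝ) ≤ δ := by exact_mod_cast h.le
    -- Scaling by `N / δ` puts all degrees into `[N, μ N]` up to an error `r`. Hence `s = N - r`,
    -- and `μ N + r ≤ μ (N + r)` because `μ ≥ 1`.
    obtain ⟨F, hF⟩ := exists_near_fraction hU (q := N / δ) (by positivity)
      ((div_le_one hδ0).mpr hNδ)
    refine ⟨F, N - r, by omega, Nat.sub_le _ _, fun v => ?_, fun v => ?_⟩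
    · have h1 := (abs_le.mp (hF v)).1
      have h2 : (N : ℝ) ≤ N / δ * H.degree v := by
        rw [div_mul_eq_mul_div, le_div_iff₀ hδ0]
        gcongr
        exact_mod_cast hlow v
      have h3 : ((N - r : ℕ) : ℝ) ≤ H.degreeIn F v := by
        rw [Nat.cast_sub hN.le]; linarith
      exact_mod_cast h3
    · have h1 := (abs_le.mp (hF v)).2
      have h2 : N / δ * H.degree v ≤ N * μ := by
        rw [div_mul_eq_mul_div, div_le_iff₀ hδ0, mul_assoc]
        gcongr
        exact hupp v
      rw [Nat.cast_sub hN.le, mul_assoc, mul_comm μ, ← mul_assoc, div_mul_cancel₀ _ hN'.ne']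
      nlinarith

end MultiHypergraph

/-! ### Colourings and rounding of multilinear functions -/

open scoped Classical in
-- Greedy colouring: a new element has fewer than `K` conflicts, so some colour is free.
theorem exists_proper_coloring {E : Type*} [Fintype E] (adj : E → E → Prop)
    (hsymm : ∀ e f, adj e f → adj f e) {K : ℕ}
    (hK : ∀ e, ∃ T : Finset E, T.card < K ∧ ∀ f, adj e f → f ∈ T) :
    ∃ col : E → Fin K, ∀ e f, e ≠ f → adj e f → col e ≠ col f := by
  suffices h : ∀ T : Finset E, ∃ col : E → Fin K,
      ∀ e ∈ T, ∀ f ∈ T, e ≠ f → adj e f → col e ≠ col f by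
    obtain ⟨col, hcol⟩ := h Finset.univ
    exact ⟨col, fun e f => hcol e (Finset.mem_univ _) f (Finset.mem_univ _)⟩
  intro T
  induction T using Finset.induction_on with
  | empty =>
    exact ⟨fun e => ⟨0, by obtain ⟨T, hT, -⟩ := hK e; omega⟩, by simp⟩
  | insert e T he ih =>
    obtain ⟨col, hcol⟩ := ih
    obtain ⟨U, hU, hUadj⟩ := hK e
    obtain ⟨k, hk⟩ : ∃ k, k ∉ U.image col := by
      by_contra! h
      have h1 := Finset.card_le_card (fun k _ => h k : (Finset.univ : Finset (Fin K)) ⊆ _)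
      rw [Finset.card_univ, Fintype.card_fin] at h1
      exact absurd (h1.trans Finset.card_image_le) (not_le.mpr hU)
    have hk' : ∀ f, adj e f → col f ≠ k := fun f hf h =>
      hk (Finset.mem_image.mpr ⟨f, hUadj f hf, h⟩)
    refine ⟨Function.update col e k, fun f hf g hg hfg hadj => ?_⟩
    rcases Finset.mem_insert.mp hf with rfl | hf
    · rw [Function.update_self, Function.update_of_ne hfg.symm]
      exact (hk' g hadj).symm
    · rcases Finset.mem_insert.mp hg with rfl | hg
      · rw [Function.update_self, Function.update_of_ne hfg]
        exact hk' f (hsymm _ _ hadj)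
      · rw [Function.update_of_ne (ne_of_mem_of_not_mem hf he),
          Function.update_of_ne (ne_of_mem_of_not_mem hg he)]
        exact hcol f hf g hg hfg hadj

/-- Rounding for functions that are affine in the variables of each colour class. -/
theorem exists_classwise_rounding {E C : Type*} [Fintype E] [Fintype C] {K : ℕ} (col : E → Fin K)
    (G : C → (E → ℝ) → ℝ) (a : C → E → ℝ) {B : ℝ} (hB : 0 ≤ B) (ha : ∀ e, ∑ c, a c e ≤ B)
    (hG : ∀ (k : Fin K) (x : E → ℝ), (∀ e, 0 ≤ x e ∧ x e ≤ 1) → ∃ b : C → E → ℝ,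
      (∀ c e, |b c e| ≤ a c e) ∧ ∀ y : E → ℝ, (∀ e, col e ≠ k → y e = x e) →
        ∀ c, G c y - G c x = ∑ e, b c e * (y e - x e))
    (x : E → ℝ) (hx : ∀ e, 0 ≤ x e ∧ x e ≤ 1) :
    ∃ y : E → ℝ, (∀ e, y e = 0 ∨ y e = 1) ∧ ∀ c, G c y ≤ G c x + K * B := by
  suffices h : ∀ n ≤ K, ∃ y : E → ℝ, (∀ e, 0 ≤ y e ∧ y e ≤ 1) ∧
      (∀ e, (col e : ℕ) < n → y e = 0 ∨ y e = 1) ∧ ∀ c, G c y ≤ G c x + n * B by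
    obtain ⟨y, -, hy, hyG⟩ := h K le_rfl
    exact ⟨y, fun e => hy e (col e).2, hyG⟩
  intro n
  induction n with
  | zero => exact fun _ => ⟨x, hx, by simp, by simp⟩
  | succ n ih =>
    intro hn
    obtain ⟨u, hu, hun, huG⟩ := ih (by omega)
    obtain ⟨b, hba, hb⟩ := hG ⟨n, hn⟩ u hu
    have hab : ∀ c e, |if (col e : ℕ) = n then b c e else 0| ≤ a c e := by
      intro c e
      split_ifs
      · exact hba c e
      · simpa using (abs_nonneg _).trans (hba c e)
    -- Only class `n` is rounded, using the affine expansion at the current point `u`; the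
    -- coefficients outside the class are set to zero. Each class costs `B`.
    obtain ⟨y, hy, -, hyB⟩ := exists_rounding
      (fun c e => if (col e : ℕ) = n then b c e else 0) hB
      (fun e => (Finset.sum_le_sum fun c _ => hab c e).trans (ha e)) u hu
    refine ⟨fun e => if (col e : ℕ) = n then y e else u e, fun e => ?_, fun e he => ?_, fun c => ?_⟩
    · dsimp only
      split_ifs
      · rcases hy e with h | h <;> rw [h] <;> norm_num
      · exact hu e
    · dsimp only
      split_ifs with h
      · exact hy e
      · exact hun e (by omega)
    · have h1 := hb (fun e => if (col e : ℕ) = n then y e else u e)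
        (fun e he => if_neg fun h => he (Fin.ext h)) c
      have h2 : ∑ e, b c e * ((if (col e : ℕ) = n then y e else u e) - u e) =
          ∑ e, (if (col e : ℕ) = n then b c e else 0) * (y e - u e) :=
        Finset.sum_congr rfl fun e _ => by split_ifs <;> simp
      have h3 := (abs_le.mp (hyB c)).2
      rw [h2] at h1
      push_cast
      linarith [huG c]

open scoped Classical in
-- At most one factor belongs to colour `k`, so the product is affine in the variables of that
-- class. This is the form of expansion that `exists_classwise_rounding` asks for.
theorem prod_one_sub_sub_of_rainbow {E ι : Type*} [Fintype E] {col : E → ι} {S : Finset E}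
    (hS : ∀ e ∈ S, ∀ f ∈ S, e ≠ f → col e ≠ col f) {k : ι} {x y : E → ℝ}
    (hxy : ∀ e, col e ≠ k → y e = x e) :
    ∏ f ∈ S, (1 - y f) - ∏ f ∈ S, (1 - x f) =
      ∑ e, (if e ∈ S then -∏ f ∈ S.erase e, (1 - x f) else 0) * (y e - x e) := by
  by_cases h : ∃ g ∈ S, col g = k
  · obtain ⟨g, hgS, hgk⟩ := h
    have hoth : ∀ f ∈ S, f ≠ g → y f = x f := fun f hf hfg =>
      hxy f fun h => hS f hf g hgS hfg (h.trans hgk.symm)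
    rw [Finset.sum_eq_single g, if_pos hgS, ← Finset.mul_prod_erase S _ hgS,
      ← Finset.mul_prod_erase S (fun f => 1 - x f) hgS,
      Finset.prod_congr rfl fun f hf => by
        rw [hoth f (Finset.mem_of_mem_erase hf) (Finset.ne_of_mem_erase hf)]]
    · ring
    · intro e _ he
      by_cases heS : e ∈ S
      · rw [hoth e heS he, sub_self, mul_zero]
      · rw [if_neg heS, zero_mul]
    · simp
  · push Not at h
    have hoth : ∀ f ∈ S, y f = x f := fun f hf => hxy f (h f hf)
    rw [Finset.prod_congr rfl fun f hf => by rw [hoth f hf], sub_self]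
    refine (Finset.sum_eq_zero fun e _ => ?_).symm
    by_cases heS : e ∈ S
    · rw [hoth e heS, sub_self, mul_zero]
    · rw [if_neg heS, zero_mul]

/-! ### Partial cover and repair -/

namespace MultiHypergraph

variable {V E : Type*} [Fintype V] {H : MultiHypergraph V E} {r s : ℕ}

open scoped Classical in
theorem card_filter_mem_le (hU : H.IsUniform r) {S : V → Finset E}
    (hSv : ∀ v, ∀ e ∈ S v, v ∈ H.edge e) (e : E) :
    (Finset.univ.filter fun v => e ∈ S v).card ≤ r := by
  rw [← hU e]
  exact Finset.card_le_card fun v hv => hSv v e (by simpa using hv)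

open scoped Classical in
theorem sum_degreeIn_eq (hU : H.IsUniform r) (T : Finset E) :
    ∑ w, (H.degreeIn T w : ℝ) = r * T.card := by
  simp_rw [degreeIn_eq_sum]
  rw [Finset.sum_comm, Finset.sum_congr rfl fun e _ => hU.sum_ite_mem e]
  simp [mul_comm]

open scoped Classical in
-- Double counting: an edge belongs to `S v` only for `v` among its own `r` vertices. The factor `r`
-- is later cancelled by the probability `1 / r` of staying uncovered.
theorem sum_degreeIn_le (hU : H.IsUniform r) {F : Finset E} {S : V → Finset E}
    (hSF : ∀ v, S v ⊆ F) (hSv : ∀ v, ∀ e ∈ S v, v ∈ H.edge e) (w : V) :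
    ∑ v, (H.degreeIn (S v) w : ℝ) ≤ r * H.degreeIn F w := by
  have h : ∀ v, (H.degreeIn (S v) w : ℝ) =
      ∑ e ∈ F, if e ∈ S v then (if w ∈ H.edge e then (1 : ℝ) else 0) else 0 := by
    intro v
    rw [degreeIn_eq_sum, ← Finset.sum_filter (s := F) (fun e => e ∈ S v)]
    refine Finset.sum_congr ?_ fun _ _ => rfl
    ext e
    simpa using fun he => hSF v he
  simp_rw [h]
  rw [Finset.sum_comm, degreeIn_eq_sum, Finset.mul_sum]
  refine Finset.sum_le_sum fun e _ => ?_
  rw [← Finset.sum_filter, Finset.sum_const, nsmul_eq_mul]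
  gcongr
  exact card_filter_mem_le hU hSv e

open scoped Classical in
/-- Derandomized sampling: a set `M` of edges for which the degree plus `γ` times the weighted
number of vertices left uncovered is close to its expectation under sampling with
probability `p`. -/
theorem exists_partial_cover [Fintype E] (hU : H.IsUniform r) {F : Finset E} {S : V → Finset E}
    (hSF : ∀ v, S v ⊆ F) (hSv : ∀ v, ∀ e ∈ S v, v ∈ H.edge e) (hSs : ∀ v, (S v).card = s)
    {p γ : ℝ} (hp : 0 ≤ p ∧ p ≤ 1) (hγ : 0 ≤ γ) :
    ∃ M : Finset E, ∀ w,
      (H.degreeIn M w : ℝ) + γ * ∑ v, (if Disjoint (S v) M then (H.degreeIn (S v) w : ℝ) else 0) ≤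
        p * H.degreeIn F w + γ * (1 - p) ^ s * (r * H.degreeIn F w) +
          (r * s + 1 : ℕ) * (r + γ * (r * (r * s))) := by
  -- Edges sharing some `S v` get different colours. An edge lies in at most `r` of these sets, each
  -- of size `s`, so `r * s + 1` colours suffice.
  obtain ⟨col, hcol⟩ := exists_proper_coloring (fun e f : E => ∃ v, e ∈ S v ∧ f ∈ S v)
    (fun e f ⟨v, h1, h2⟩ => ⟨v, h2, h1⟩) (K := r * s + 1) (fun e => by
      refine ⟨(Finset.univ.filter fun v => e ∈ S v).biUnion S,
        Nat.lt_succ_of_le (Finset.card_biUnion_le.trans ?_), fun f hf => by simpa using hf⟩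
      rw [Finset.sum_congr rfl fun v _ => hSs v, Finset.sum_const, smul_eq_mul]
      exact Nat.mul_le_mul_right _ (card_filter_mem_le hU hSv e))
  obtain ⟨y, hy, hyG⟩ := exists_classwise_rounding (C := V) col
    -- The multilinear extension of the target: its value at the constant point `p` is the
    -- expectation, and at a 0/1 point the product is the indicator that `S v` is missed.
    (fun w x => ∑ e, (if e ∈ F ∧ w ∈ H.edge e then (1 : ℝ) else 0) * x e +
      γ * ∑ v, (H.degreeIn (S v) w : ℝ) * ∏ f ∈ S v, (1 - x f))
    (fun w e => (if w ∈ H.edge e then (1 : ℝ) else 0) +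
      γ * ∑ v, (H.degreeIn (S v) w : ℝ) * if e ∈ S v then (1 : ℝ) else 0)
    (B := r + γ * (r * (r * s))) (by positivity)
    (fun e => by
      rw [Finset.sum_add_distrib, hU.sum_ite_mem, ← Finset.mul_sum, Finset.sum_comm]
      gcongr
      simp_rw [← Finset.sum_mul, sum_degreeIn_eq hU, hSs]
      rw [← Finset.mul_sum, Finset.sum_boole, mul_comm]
      gcongr
      exact card_filter_mem_le hU hSv e)
    (fun k x hx => by
      refine ⟨fun w e => (if e ∈ F ∧ w ∈ H.edge e then (1 : ℝ) else 0) +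
        γ * ∑ v, (H.degreeIn (S v) w : ℝ) *
          if e ∈ S v then -∏ f ∈ (S v).erase e, (1 - x f) else 0, fun w e => ?_,
        fun z hz w => ?_⟩
      · refine (abs_add_le _ _).trans (add_le_add ?_ ?_)
        · by_cases h1 : w ∈ H.edge e <;> by_cases h2 : e ∈ F <;> simp [h1, h2]
        · rw [abs_mul, abs_of_nonneg hγ]
          gcongr
          refine (Finset.abs_sum_le_sum_abs _ _).trans (Finset.sum_le_sum fun v _ => ?_)
          rw [abs_mul, Nat.abs_cast]
          gcongr
          split_ifs
          · rw [abs_neg, Finset.abs_prod]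
            refine Finset.prod_le_one (fun _ _ => abs_nonneg _) fun f _ => ?_
            rw [abs_le]
            constructor <;> linarith [(hx f).1, (hx f).2]
          · simp
      · have h1 : ∀ v, ∏ f ∈ S v, (1 - z f) = ∏ f ∈ S v, (1 - x f) +
            ∑ e, (if e ∈ S v then -∏ f ∈ (S v).erase e, (1 - x f) else 0) * (z e - x e) := by
          intro v
          rw [← prod_one_sub_sub_of_rainbow (col := col) (k := k)
            (fun e he f hf hef => hcol e f hef ⟨v, he, hf⟩) hz]
          ring
        simp_rw [h1, mul_add, Finset.sum_add_distrib, add_mul, Finset.sum_add_distrib]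
        have h2 : ∑ e, (γ * ∑ v, (H.degreeIn (S v) w : ℝ) *
              if e ∈ S v then -∏ f ∈ (S v).erase e, (1 - x f) else 0) * (z e - x e) =
            γ * ∑ v, (H.degreeIn (S v) w : ℝ) *
              ∑ e, (if e ∈ S v then -∏ f ∈ (S v).erase e, (1 - x f) else 0) * (z e - x e) := by
          simp_rw [Finset.mul_sum, Finset.sum_mul]
          rw [Finset.sum_comm]
          simp_rw [mul_assoc]
        rw [h2]
        simp_rw [mul_sub, Finset.sum_sub_distrib]
        ring)
    (fun _ => p) (fun _ => hp)
  refine ⟨F.filter fun e => y e = 1, fun w => ?_⟩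
  have h1 : (H.degreeIn (F.filter fun e => y e = 1) w : ℝ) =
      ∑ e, (if e ∈ F ∧ w ∈ H.edge e then (1 : ℝ) else 0) * y e := by
    rw [degreeIn_eq_sum, Finset.sum_filter, ← Finset.sum_subset (Finset.subset_univ F)
      fun e _ he => by simp [he]]
    refine Finset.sum_congr rfl fun e he => ?_
    rcases hy e with h | h <;> simp [h, he]
  have h2 : ∀ v, (if Disjoint (S v) (F.filter fun e => y e = 1) then
      (H.degreeIn (S v) w : ℝ) else 0) = H.degreeIn (S v) w * ∏ f ∈ S v, (1 - y f) := by
    intro v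
    split_ifs with h
    · rw [Finset.prod_eq_one, mul_one]
      intro f hf
      have h3 := Finset.disjoint_left.mp h hf
      rcases hy f with h4 | h4
      · rw [h4, sub_zero]
      · exact absurd (Finset.mem_filter.mpr ⟨hSF v hf, h4⟩) h3
    · obtain ⟨f, hf, hf'⟩ := Finset.not_disjoint_iff.mp h
      rw [Finset.prod_eq_zero hf, mul_zero]
      rw [(Finset.mem_filter.mp hf').2, sub_self]
  have h3 : ∑ e, (if e ∈ F ∧ w ∈ H.edge e then (1 : ℝ) else 0) * p = p * H.degreeIn F w := by
    rw [degreeIn_eq_sum, Finset.mul_sum, ← Finset.sum_subset (Finset.subset_univ F)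
      fun e _ he => by simp [he]]
    refine Finset.sum_congr rfl fun e he => ?_
    simp [he]
  have h4 : ∑ v, (H.degreeIn (S v) w : ℝ) * ∏ f ∈ S v, (1 - p) ≤
      (1 - p) ^ s * (r * H.degreeIn F w) := by
    simp_rw [Finset.prod_const, hSs]
    rw [← Finset.sum_mul, mul_comm]
    have : 0 ≤ 1 - p := by linarith [hp.2]
    gcongr
    exact sum_degreeIn_le hU hSF hSv w
  have h5 := hyG w
  simp only [h3] at h5
  have h6 := mul_le_mul_of_nonneg_left h4 hγ
  rw [h1, Finset.sum_congr rfl fun v _ => h2 v]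
  linarith

open scoped Classical in
/-- Completing a set of edges to a hitting set, where each uncovered vertex `v` distributes its
demand evenly over the edges in `S v`. -/
theorem exists_repair [Fintype E] (hU : H.IsUniform r) (hr : 0 < r) {S : V → Finset E}
    (hSv : ∀ v, ∀ e ∈ S v, v ∈ H.edge e) (hSs : ∀ v, (S v).card = s) (hs : 2 ≤ s) (M : Finset E) :
    ∃ N : Finset E, H.IsHitting N ∧ ∀ w, (H.degreeIn N w : ℝ) ≤ H.degreeIn M w +
      21 / 20 / s * ∑ v, (if Disjoint (S v) M then (H.degreeIn (S v) w : ℝ) else 0) + 41 * r := by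
  have hr0 : (0 : ℝ) < r := by exact_mod_cast hr
  have hs2 : (2 : ℝ) ≤ s := by exact_mod_cast hs
  have hs0 : (0 : ℝ) < s := by linarith
  -- The variable `(v, e)` says that `v` asks for `e`. An uncovered vertex has total demand `21 /
  -- 20`. The factor `40 r` on the demand rows reduces their rounding error to `41 / 40 < 21 / 20`,
  -- so some request survives, while the degree rows lose at most `41 r`.
  obtain ⟨y, hy, hyx, hyB⟩ := exists_rounding (I := V × E) (C := V ⊕ V)
    (Sum.elim (fun v i => if v = i.1 then 40 * (r : ℝ) else 0)
      (fun w i => if w ∈ H.edge i.2 then 1 else 0)) (B := 41 * r) (by positivity)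
    (fun i => by
      rw [Fintype.sum_sum_type]
      have h1 : ∑ v : V, |(if v = i.1 then 40 * (r : ℝ) else 0)| = 40 * r := by
        rw [Finset.sum_eq_single i.1] <;> simp +contextual
      have h2 : ∑ w : V, |(if w ∈ H.edge i.2 then (1 : ℝ) else 0)| = r := by
        rw [← hU.sum_ite_mem i.2]
        exact Finset.sum_congr rfl fun v _ => by split_ifs <;> simp
      simp only [Sum.elim_inl, Sum.elim_inr]
      rw [h1, h2]
      linarith)
    (fun i => if Disjoint (S i.1) M ∧ i.2 ∈ S i.1 then 21 / 20 / (s : ℝ) else 0)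
    (fun i => by
      split_ifs
      · refine ⟨by positivity, ?_⟩
        rw [div_le_one hs0]
        linarith
      · norm_num)
  -- Rounding keeps integral coordinates, so a request that started at 0 stays at 0.
  have hyS : ∀ v e, y (v, e) = 1 → e ∈ S v := by
    intro v e h
    by_contra he
    have := hyx (v, e) (by simp [he])
    rw [h] at this
    simp [he] at this
  refine ⟨M ∪ Finset.univ.filter fun e => ∃ v, y (v, e) = 1, fun v => ?_, fun w => ?_⟩
  · suffices h : ∃ e ∈ M ∪ Finset.univ.filter fun e => ∃ v, y (v, e) = 1, v ∈ H.edge e by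
      obtain ⟨e, he, hve⟩ := h
      exact Finset.card_pos.mpr ⟨e, Finset.mem_filter.mpr ⟨he, hve⟩⟩
    by_cases hd : Disjoint (S v) M
    · have h1 := (abs_le.mp (hyB (Sum.inl v))).1
      simp only [Sum.elim_inl] at h1
      rw [Fintype.sum_prod_type, Finset.sum_eq_single v (fun u _ hu => by simp [hu.symm])
        (by simp)] at h1
      simp only [if_true, hd, true_and] at h1
      rw [← Finset.mul_sum, Finset.sum_sub_distrib, ← Finset.sum_filter, Finset.sum_const,
        Finset.filter_mem_eq_inter, Finset.univ_inter, hSs, nsmul_eq_mul,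
        mul_div_cancel₀ _ hs0.ne'] at h1
      have h2 : 0 < ∑ e, y (v, e) := by
        by_contra! h
        nlinarith
      obtain ⟨e, -, he⟩ := Finset.exists_ne_zero_of_sum_ne_zero h2.ne'
      have he1 : y (v, e) = 1 := (hy (v, e)).resolve_left he
      exact ⟨e, Finset.mem_union_right _ (by simpa using ⟨v, he1⟩), hSv v e (hyS v e he1)⟩
    · obtain ⟨e, he, heM⟩ := Finset.not_disjoint_iff.mp hd
      exact ⟨e, Finset.mem_union_left _ heM, hSv v e he⟩
  · have h1 := (abs_le.mp (hyB (Sum.inr w))).2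
    simp only [Sum.elim_inr, mul_sub, Finset.sum_sub_distrib] at h1
    have h2 : (H.degreeIn (M ∪ Finset.univ.filter fun e => ∃ v, y (v, e) = 1) w : ℝ) ≤
        H.degreeIn M w + H.degreeIn (Finset.univ.filter fun e => ∃ v, y (v, e) = 1) w := by
      unfold degreeIn
      rw [Finset.filter_union]
      exact_mod_cast Finset.card_union_le _ _
    have h3 : (H.degreeIn (Finset.univ.filter fun e => ∃ v, y (v, e) = 1) w : ℝ) ≤
        ∑ i : V × E, (if w ∈ H.edge i.2 then 1 else 0) * y i := by
      rw [degreeIn_eq_sum, Finset.sum_filter, Fintype.sum_prod_type, Finset.sum_comm]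
      refine Finset.sum_le_sum fun e _ => ?_
      have hnn : ∀ v, 0 ≤ y (v, e) := fun v => by rcases hy (v, e) with h | h <;> simp [h]
      by_cases hw : w ∈ H.edge e
      · simp only [hw, if_true, one_mul]
        split_ifs with h
        · obtain ⟨v, hv⟩ := h
          rw [← hv]
          exact Finset.single_le_sum (fun v _ => hnn v) (Finset.mem_univ v)
        · exact Finset.sum_nonneg fun v _ => hnn v
      · simp [hw]
    have h4 : ∑ i : V × E, (if w ∈ H.edge i.2 then (1 : ℝ) else 0) *
          (if Disjoint (S i.1) M ∧ i.2 ∈ S i.1 then 21 / 20 / (s : ℝ) else 0) =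
        21 / 20 / s *
          ∑ v, (if Disjoint (S v) M then (H.degreeIn (S v) w : ℝ) else 0) := by
      rw [Fintype.sum_prod_type, Finset.mul_sum]
      refine Finset.sum_congr rfl fun v _ => ?_
      by_cases hd : Disjoint (S v) M
      · simp only [hd, true_and, if_true]
        rw [degreeIn_eq_sum, Finset.mul_sum, ← Finset.sum_subset (Finset.subset_univ (S v))
          fun e _ he => by simp [he]]
        refine Finset.sum_congr rfl fun e he => ?_
        simp [he]
      · simp [hd]
    rw [h4] at h1
    linarith

end MultiHypergraph

/-! ### Product measures and the local lemma -/

/-- The expectation of `f` when every coordinate is `true` with probability `p`, independently. -/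
noncomputable def bernoulliMean {E : Type*} [Fintype E] [DecidableEq E] (p : ℝ)
    (f : (E → Bool) → ℝ) : ℝ :=
  ∑ ω, (∏ e, if ω e then p else 1 - p) * f ω

section BernoulliMean

variable {E : Type*} [Fintype E] [DecidableEq E] {p : ℝ}

theorem bernoulliMean_prod (g : E → Bool → ℝ) :
    bernoulliMean p (fun ω => ∏ e, g e (ω e)) = ∏ e, (p * g e true + (1 - p) * g e false) := by
  have h := Finset.prod_univ_sum (fun _ : E => (Finset.univ : Finset Bool))
    (fun e b => (if b then p else 1 - p) * g e b)
  simp only [Fintype.sum_bool, if_true, Bool.false_eq_true, if_false,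
    Fintype.piFinset_univ] at h
  rw [h, bernoulliMean]
  exact Finset.sum_congr rfl fun ω _ => by rw [Finset.prod_mul_distrib]

theorem bernoulliMean_one : bernoulliMean p (fun _ : E → Bool => 1) = 1 := by
  simpa using bernoulliMean_prod (E := E) (p := p) (fun _ _ => 1)

theorem bernoulliMean_mono (hp : 0 ≤ p ∧ p ≤ 1) {f g : (E → Bool) → ℝ} (h : ∀ ω, f ω ≤ g ω) :
    bernoulliMean p f ≤ bernoulliMean p g := by
  refine Finset.sum_le_sum fun ω _ => mul_le_mul_of_nonneg_left (h ω) ?_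
  refine Finset.prod_nonneg fun e _ => ?_
  split_ifs <;> linarith [hp.1, hp.2]

theorem bernoulliMean_sub (f g : (E → Bool) → ℝ) :
    bernoulliMean p (fun ω => f ω - g ω) = bernoulliMean p f - bernoulliMean p g := by
  simp [bernoulliMean, mul_sub, Finset.sum_sub_distrib]

theorem bernoulliMean_const_mul (c : ℝ) (f : (E → Bool) → ℝ) :
    bernoulliMean p (fun ω => c * f ω) = c * bernoulliMean p f := by
  simp only [bernoulliMean, Finset.mul_sum]
  exact Finset.sum_congr rfl fun ω _ => by ring

/-- Functions of disjoint sets of coordinates are independent. -/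
theorem bernoulliMean_mul {f g : (E → Bool) → ℝ} {S T : Set E} (hf : DependsOn f S)
    (hg : DependsOn g T) (hST : Disjoint S T) :
    bernoulliMean p (fun ω => f ω * g ω) = bernoulliMean p f * bernoulliMean p g := by
  classical
  set Φ := Equiv.piEquivPiSubtypeProd (fun e => e ∈ S) (fun _ => Bool) with hΦ
  set A : ((E → Bool) → ℝ) → ℝ := fun f => ∑ a : {e // e ∈ S} → Bool,
    (∏ e, if a e then p else 1 - p) * f (Φ.symm (a, fun _ => true)) with hA
  set B : ((E → Bool) → ℝ) → ℝ := fun g => ∑ b : {e // e ∉ S} → Bool,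
    (∏ e, if b e then p else 1 - p) * g (Φ.symm (fun _ => true, b)) with hB
  -- The mean splits into a factor over `S` and one over its complement. The filler value `true` is
  -- harmless, as neither function sees those coordinates. The case of constants gives `A 1 * B 1 =
  -- 1`, which normalizes the factors.
  have key : ∀ f g : (E → Bool) → ℝ, DependsOn f S → DependsOn g T →
      bernoulliMean p (fun ω => f ω * g ω) = A f * B g := by
    intro f g hf hg
    rw [hA, hB, Finset.sum_mul_sum, ← Finset.sum_product', Finset.univ_product_univ,
      bernoulliMean, ← Equiv.sum_comp Φ.symm]
    refine Finset.sum_congr rfl fun ab _ => ?_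
    obtain ⟨a, b⟩ := ab
    have h1 : f (Φ.symm (a, b)) = f (Φ.symm (a, fun _ => true)) :=
      hf fun e he => by simp [hΦ, Equiv.piEquivPiSubtypeProd, he]
    have h2 : g (Φ.symm (a, b)) = g (Φ.symm (fun _ => true, b)) :=
      hg fun e he => by
        have : e ∉ S := fun h => Set.disjoint_left.mp hST h he
        simp [hΦ, Equiv.piEquivPiSubtypeProd, this]
    have h3 : (∏ e, if Φ.symm (a, b) e then p else 1 - p) =
        (∏ e, if a e then p else 1 - p) * ∏ e, if b e then p else 1 - p := by
      rw [← Fintype.prod_subtype_mul_prod_subtype (fun e => e ∈ S)]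
      congr 1
      · refine Finset.prod_congr rfl fun e _ => ?_
        simp [hΦ, Equiv.piEquivPiSubtypeProd, e.2]
      · refine Finset.prod_congr rfl fun e _ => ?_
        simp [hΦ, Equiv.piEquivPiSubtypeProd, e.2]
    rw [h1, h2, h3]
    ring
  have hone : ∀ U : Set E, DependsOn (fun _ : E → Bool => (1 : ℝ)) U := fun U _ _ _ => rfl
  have h1 := key f _ hf (hone T)
  have h2 := key _ g (hone S) hg
  have h3 := key _ _ (hone S) (hone T)
  simp only [mul_one, one_mul] at h1 h2 h3
  rw [bernoulliMean_one] at h3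
  rw [key f g hf hg, h1, h2]
  linear_combination (A f * B g) * h3

/-- The moment generating function of a binomial variable. -/
theorem bernoulliMean_exp_le (hp : 0 ≤ p ∧ p ≤ 1) (T : Finset E) (θ : ℝ) :
    bernoulliMean p (fun ω => Real.exp (θ * (T.filter fun e => ω e = true).card)) ≤
      Real.exp (p * T.card * (Real.exp θ - 1)) := by
  have h1 : (fun ω : E → Bool => Real.exp (θ * (T.filter fun e => ω e = true).card)) =
      fun ω => ∏ e, if e ∈ T then (if ω e = true then Real.exp θ else 1) else 1 := by
    funext ω
    rw [Finset.prod_ite, Finset.prod_const_one, mul_one, Finset.prod_ite, Finset.prod_const_one,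
      mul_one, Finset.prod_const, ← Real.exp_nat_mul, mul_comm]
    congr 4
    ext e
    simp
  rw [h1]
  refine (bernoulliMean_prod fun e b =>
    if e ∈ T then (if b = true then Real.exp θ else 1) else 1).trans_le ?_
  calc ∏ e, (p * (if e ∈ T then (if true = true then Real.exp θ else 1) else 1) +
          (1 - p) * if e ∈ T then (if false = true then Real.exp θ else 1) else 1)
      = ∏ e ∈ T, (1 + p * (Real.exp θ - 1)) := by
        rw [← Finset.prod_subset (Finset.subset_univ T) fun e _ he => by simp [he]]
        refine Finset.prod_congr rfl fun e he => ?_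
        simp [he]
        ring
    _ = (1 + p * (Real.exp θ - 1)) ^ T.card := Finset.prod_const _
    _ ≤ Real.exp (p * (Real.exp θ - 1)) ^ T.card := by
        gcongr
        · nlinarith [Real.exp_pos θ, hp.1, hp.2]
        · linarith [Real.add_one_le_exp (p * (Real.exp θ - 1))]
    _ = Real.exp (p * T.card * (Real.exp θ - 1)) := by
        rw [← Real.exp_nat_mul]
        ring_nf

/-- **The Lovász local lemma** in the variable setting, with a constant weight `x`, for
`[0, 1]`-valued random variables in place of events. -/
theorem exists_forall_lt_one_of_local {ι : Type*} [Fintype ι] (hp : 0 ≤ p ∧ p ≤ 1)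
    (Z : ι → (E → Bool) → ℝ) (hZ : ∀ i ω, 0 ≤ Z i ω ∧ Z i ω ≤ 1) (vbl : ι → Finset E)
    (hvbl : ∀ i, DependsOn (Z i) (vbl i : Set E)) (n : ι → ℕ)
    (hn : ∀ i, (Finset.univ.filter fun j => ¬Disjoint (vbl i) (vbl j)).card ≤ n i)
    {x : ℝ} (hx : 0 ≤ x ∧ x < 1) (hP : ∀ i, bernoulliMean p (Z i) ≤ x * (1 - x) ^ n i) :
    ∃ ω, ∀ i, Z i ω < 1 := by
  classical
  set Q : Finset ι → (E → Bool) → ℝ := fun S ω => ∏ i ∈ S, (1 - Z i ω) with hQ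
  have hQ0 : ∀ S ω, 0 ≤ Q S ω := fun S ω =>
    Finset.prod_nonneg fun i _ => by linarith [(hZ i ω).2]
  have hQm : ∀ S, 0 ≤ bernoulliMean p (Q S) := fun S =>
    Finset.sum_nonneg fun ω _ => mul_nonneg
      (Finset.prod_nonneg fun e _ => by split_ifs <;> linarith [hp.1, hp.2]) (hQ0 S ω)
  have hins : ∀ (j : ι) (T : Finset ι), j ∉ T →
      bernoulliMean p (Q (insert j T)) =
        bernoulliMean p (Q T) - bernoulliMean p (fun ω => Z j ω * Q T ω) := by
    intro j T hj
    rw [← bernoulliMean_sub]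
    congr 1
    funext ω
    simp only [hQ, Finset.prod_insert hj]
    ring
  have hx1 : 0 ≤ 1 - x := by linarith [hx.2]
  -- The chain rule: each further factor `1 - Z j` costs at most a factor `1 - x` in the mean.
  have grow : ∀ (m : ℕ),
      (∀ (T : Finset ι), T.card < m → ∀ j,
        bernoulliMean p (fun ω => Z j ω * Q T ω) ≤ x * bernoulliMean p (Q T)) →
      ∀ (S₂ S₁ : Finset ι), Disjoint S₁ S₂ → (S₁ ∪ S₂).card ≤ m →
        (1 - x) ^ S₁.card * bernoulliMean p (Q S₂) ≤ bernoulliMean p (Q (S₁ ∪ S₂)) := by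
    intro m hm S₂ S₁
    induction S₁ using Finset.induction_on with
    | empty => simp
    | insert j S₁ hj ih =>
      intro hd hc
      rw [Finset.disjoint_insert_left] at hd
      have hj' : j ∉ S₁ ∪ S₂ := by simp [hj, hd.1]
      rw [Finset.insert_union, Finset.card_insert_of_notMem hj'] at hc
      have h1 := ih hd.2 (by omega)
      have h2 := hm (S₁ ∪ S₂) (by omega) j
      rw [Finset.insert_union, hins j _ hj', Finset.card_insert_of_notMem hj, pow_succ']
      calc (1 - x) * (1 - x) ^ S₁.card * bernoulliMean p (Q S₂)
          = (1 - x) * ((1 - x) ^ S₁.card * bernoulliMean p (Q S₂)) := by ring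
        _ ≤ (1 - x) * bernoulliMean p (Q (S₁ ∪ S₂)) := by gcongr
        _ ≤ _ := by linarith
  have main : ∀ (m : ℕ) (S : Finset ι), S.card = m → ∀ i,
      bernoulliMean p (fun ω => Z i ω * Q S ω) ≤ x * bernoulliMean p (Q S) := by
    intro m
    induction m using Nat.strong_induction_on with
    | _ m ih =>
    intro S hS i
    -- `S₁` holds the possible dependencies of `i`. Dropping their factors gives independence from
    -- the rest; `grow` pays for putting them back.
    set S₁ := S.filter fun j => ¬Disjoint (vbl i) (vbl j) with hS₁
    set S₂ := S.filter fun j => Disjoint (vbl i) (vbl j) with hS₂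
    have hunion : S₁ ∪ S₂ = S := by
      rw [Finset.union_comm]
      exact Finset.filter_union_filter_not_eq _ S
    have hdisj : Disjoint S₁ S₂ := (Finset.disjoint_filter_filter_not S S _).symm
    have h1 := grow m (fun T hT j => ih T.card hT T rfl j) S₂ S₁ hdisj (by rw [hunion, hS])
    rw [hunion] at h1
    have hcard : S₁.card ≤ n i :=
      (Finset.card_le_card (Finset.filter_subset_filter _ (Finset.subset_univ S))).trans (hn i)
    have hdep : DependsOn (Q S₂) (⋃ j ∈ S₂, (vbl j : Set E)) := by
      intro ω ω' h
      refine Finset.prod_congr rfl fun j hj => ?_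
      rw [hvbl j fun e he => h e (Set.mem_biUnion hj he)]
    have hindep : bernoulliMean p (fun ω => Z i ω * Q S₂ ω) =
        bernoulliMean p (Z i) * bernoulliMean p (Q S₂) := by
      refine bernoulliMean_mul (hvbl i) hdep (Set.disjoint_iUnion₂_right.mpr fun j hj => ?_)
      exact Finset.disjoint_coe.mpr (Finset.mem_filter.mp hj).2
    calc bernoulliMean p (fun ω => Z i ω * Q S ω)
        ≤ bernoulliMean p (fun ω => Z i ω * Q S₂ ω) := by
          refine bernoulliMean_mono hp fun ω => mul_le_mul_of_nonneg_left ?_ (hZ i ω).1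
          rw [← hunion]
          simp only [hQ]
          rw [Finset.prod_union hdisj]
          refine mul_le_of_le_one_left (hQ0 S₂ ω) ?_
          exact Finset.prod_le_one (fun j _ => by linarith [(hZ j ω).2])
            fun j _ => by linarith [(hZ j ω).1]
      _ = bernoulliMean p (Z i) * bernoulliMean p (Q S₂) := hindep
      _ ≤ x * (1 - x) ^ n i * bernoulliMean p (Q S₂) :=
          mul_le_mul_of_nonneg_right (hP i) (hQm S₂)
      _ ≤ x * (1 - x) ^ S₁.card * bernoulliMean p (Q S₂) := by
          refine mul_le_mul_of_nonneg_right (mul_le_mul_of_nonneg_left ?_ hx.1) (hQm S₂)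
          exact pow_le_pow_of_le_one hx1 (by linarith [hx.1]) hcard
      _ = x * ((1 - x) ^ S₁.card * bernoulliMean p (Q S₂)) := by ring
      _ ≤ x * bernoulliMean p (Q S) := mul_le_mul_of_nonneg_left h1 hx.1
  have hfin := grow (Fintype.card ι) (fun T _ j => main _ T rfl j) ∅ Finset.univ (by simp)
    (by simp)
  have hpos : 0 < bernoulliMean p (Q (Finset.univ ∪ ∅)) := by
    refine lt_of_lt_of_le ?_ hfin
    have : bernoulliMean p (Q ∅) = 1 := by
      simpa [hQ] using bernoulliMean_one (E := E) (p := p)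
    rw [this, mul_one]
    exact pow_pos (by linarith [hx.2]) _
  by_contra! hcon
  refine hpos.ne' (Finset.sum_eq_zero fun ω _ => ?_)
  obtain ⟨i, hi⟩ := hcon ω
  have : Q (Finset.univ ∪ ∅) ω = 0 :=
    Finset.prod_eq_zero (i := i) (by simp) (by linarith [(hZ i ω).2])
  rw [this, mul_zero]

end BernoulliMean

/-- Since `exp (-2x) ≤ 1 - x` for `0 ≤ x ≤ 1/2`. With `y = r s` and `n` a multiple of `r s`, the
local lemma's condition becomes a tail bound `exp (-(log (r s) + O(1)))`. -/
theorem exp_neg_le_mul_one_sub_pow {y : ℝ} (hy : 2 ≤ y) (n : ℕ) :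
    Real.exp (-(Real.log y + 2 * n / y)) ≤ 1 / y * (1 - 1 / y) ^ n := by
  have hy0 : 0 < y := by linarith
  have hx : 1 / y ≤ 1 / 2 := one_div_le_one_div_of_le (by norm_num) hy
  have hx0 : 0 < 1 / y := by positivity
  have h1 : Real.exp (-(2 * (1 / y))) ≤ 1 - 1 / y := by
    rw [Real.exp_neg, inv_le_comm₀ (Real.exp_pos _) (by linarith)]
    refine le_trans ?_ (Real.add_one_le_exp _)
    rw [inv_le_iff_one_le_mul₀ (by linarith)]
    nlinarith
  have h2 : Real.exp (-(Real.log y + 2 * n / y)) = 1 / y * Real.exp (-(2 * (1 / y))) ^ n := by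
    rw [neg_add, Real.exp_add, Real.exp_neg, Real.exp_log hy0, ← Real.exp_nat_mul, one_div]
    congr 2
    ring
  rw [h2]
  gcongr

/-! ### Sampling with the local lemma -/

namespace MultiHypergraph

open scoped Classical in
/-- The number of events of either type that share a variable with the edge set `T`. -/
theorem card_filter_sum_le {V E : Type*} [Fintype V] {H : MultiHypergraph V E} {r : ℕ}
    (hU : H.IsUniform r) (vbl : V ⊕ V → Finset E) (T : Finset E)
    (hl : ∀ v, ∀ e ∈ vbl (Sum.inl v), v ∈ H.edge e)
    (hr : ∀ v, ∀ e ∈ vbl (Sum.inr v), v ∈ H.edge e) :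
    (Finset.univ.filter fun j => ¬Disjoint T (vbl j)).card ≤ 2 * (r * T.card) := by
  have h : (Finset.univ.filter fun j => ¬Disjoint T (vbl j)) ⊆
      (T.biUnion H.edge).disjSum (T.biUnion H.edge) := by
    intro j hj
    obtain ⟨e, heT, hej⟩ := Finset.not_disjoint_iff.mp (Finset.mem_filter.mp hj).2
    rcases j with v | v
    · exact Finset.inl_mem_disjSum.mpr (Finset.mem_biUnion.mpr ⟨e, heT, hl v e hej⟩)
    · exact Finset.inr_mem_disjSum.mpr (Finset.mem_biUnion.mpr ⟨e, heT, hr v e hej⟩)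
  have h2 : (T.biUnion H.edge).card ≤ r * T.card := by
    refine Finset.card_biUnion_le.trans ?_
    rw [Finset.sum_congr rfl fun e _ => hU e, Finset.sum_const, smul_eq_mul, mul_comm]
  refine (Finset.card_le_card h).trans ?_
  rw [Finset.card_disjSum]
  omega

open scoped Classical in
/-- Sampling the edges of `F` with probability `p`: if all degrees in `F` lie in `[s, ρ s]`, then by
the local lemma all degrees in a suitable sample lie in `(a, t)`. -/
theorem exists_sample {V E : Type*} [Fintype V] [Fintype E] {H : MultiHypergraph V E} {r s : ℕ}
    (hU : H.IsUniform r) (hr : 2 ≤ r) (hs : 1 ≤ s) {F : Finset E} {ρ : ℝ}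
    (hlow : ∀ v, s ≤ H.degreeIn F v) (hupp : ∀ v, (H.degreeIn F v : ℝ) ≤ ρ * s)
    {p θ θ' t : ℝ} {a : ℕ} (hp : 0 ≤ p ∧ p ≤ 1) (hθ : 0 ≤ θ) (hθ' : 0 ≤ θ')
    (hA : θ * a + Real.log (r * s) + 4 ≤ p * s * (1 - Real.exp (-θ)))
    (hB : p * (ρ * s) * (Real.exp θ' - 1) + Real.log (r * s) + 4 * ρ ≤ θ' * t) :
    ∃ M : Finset E, M ⊆ F ∧ ∀ v, a < H.degreeIn M v ∧ (H.degreeIn M v : ℝ) < t := by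
  -- The lower tail is tested on exactly `s` edges per vertex. Such an event has at most `2 r s`
  -- neighbours however large the degree is, which leads to the constant 4 in `hA`; full degrees
  -- give `4 ρ` in `hB`.
  have hchoose : ∀ v, ∃ S : Finset E, S ⊆ F.filter (fun e => v ∈ H.edge e) ∧ S.card = s :=
    fun v => Finset.exists_subset_card_eq (hlow v)
  choose S hS hSs using hchoose
  have hr2 : (2 : ℝ) ≤ r := by exact_mod_cast hr
  have hs1 : (1 : ℝ) ≤ s := by exact_mod_cast hs
  have hrs : (2 : ℝ) ≤ r * s := by nlinarith
  have hrs0 : (0 : ℝ) < r * s := by linarith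
  set vbl : V ⊕ V → Finset E := Sum.elim S fun w => F.filter fun e => w ∈ H.edge e with hvbl
  set cnt : Finset E → (E → Bool) → ℕ := fun T ω => (T.filter fun e => ω e = true).card with hcnt
  have hcdep : ∀ (T : Finset E) (ω ω' : E → Bool), (∀ e ∈ (T : Set E), ω e = ω' e) →
      cnt T ω = cnt T ω' := by
    intro T ω ω' h
    simp only [hcnt]
    congr 1
    exact Finset.filter_congr fun e he => by rw [h e he]
  obtain ⟨ω, hω⟩ := exists_forall_lt_one_of_local (p := p) (x := 1 / (r * s)) hp
    (Sum.elim (fun v ω => if cnt (S v) ω ≤ a then (1 : ℝ) else 0)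
      (fun w ω => if t ≤ cnt (F.filter fun e => w ∈ H.edge e) ω then (1 : ℝ) else 0))
    (by rintro (v | w) ω <;> simp only [Sum.elim_inl, Sum.elim_inr] <;> split_ifs <;> norm_num)
    vbl
    (by
      rintro (v | w) ω ω' h <;> simp only [Sum.elim_inl, Sum.elim_inr]
      · rw [hcdep (S v) ω ω' h]
      · rw [hcdep (F.filter fun e => w ∈ H.edge e) ω ω' h])
    (fun i => 2 * (r * (vbl i).card))
    (fun i => card_filter_sum_le hU vbl (vbl i)
      (fun v e he => (Finset.mem_filter.mp (hS v he)).2)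
      (fun v e he => (Finset.mem_filter.mp he).2))
    ⟨by positivity, by rw [div_lt_one hrs0]; linarith⟩
    (by
      rintro (v | w)
      · refine le_trans ?_ (exp_neg_le_mul_one_sub_pow hrs _)
        calc _ ≤ bernoulliMean p (fun ω => Real.exp (θ * a) * Real.exp (-θ * cnt (S v) ω)) := by
              refine bernoulliMean_mono hp fun ω => ?_
              simp only [Sum.elim_inl]
              split_ifs with h
              · rw [← Real.exp_add, ← Real.exp_zero]
                have : (cnt (S v) ω : ℝ) ≤ a := by exact_mod_cast h
                exact Real.exp_le_exp.mpr (by nlinarith)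
              · positivity
          _ ≤ Real.exp (θ * a) * Real.exp (p * (S v).card * (Real.exp (-θ) - 1)) := by
              rw [bernoulliMean_const_mul]
              gcongr
              exact bernoulliMean_exp_le hp (S v) (-θ)
          _ ≤ _ := by
              rw [← Real.exp_add]
              refine Real.exp_le_exp.mpr ?_
              simp only [hvbl, Sum.elim_inl, hSs]
              have : 2 * ((2 * (r * s) : ℕ) : ℝ) / (r * s) = 4 := by
                push_cast
                field_simp
                norm_num
              rw [this]
              linarith
      · refine le_trans ?_ (exp_neg_le_mul_one_sub_pow hrs _)
        have hcard : ((F.filter fun e => w ∈ H.edge e).card : ℝ) ≤ ρ * s := hupp w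
        set T := F.filter fun e => w ∈ H.edge e with hT
        calc _ ≤ bernoulliMean p (fun ω => Real.exp (-(θ' * t)) * Real.exp (θ' * cnt T ω)) := by
              refine bernoulliMean_mono hp fun ω => ?_
              simp only [Sum.elim_inr]
              split_ifs with h
              · rw [← Real.exp_add, ← Real.exp_zero]
                exact Real.exp_le_exp.mpr (by nlinarith)
              · positivity
          _ ≤ Real.exp (-(θ' * t)) * Real.exp (p * T.card * (Real.exp θ' - 1)) := by
              rw [bernoulliMean_const_mul]
              gcongr
              exact bernoulliMean_exp_le hp T θ'
          _ ≤ _ := by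
              rw [← Real.exp_add]
              refine Real.exp_le_exp.mpr ?_
              simp only [hvbl, Sum.elim_inr]
              have h1 : 2 * ((2 * (r * T.card) : ℕ) : ℝ) / (r * s) ≤ 4 * ρ := by
                rw [div_le_iff₀ hrs0]
                push_cast
                nlinarith
              have h2 : p * T.card * (Real.exp θ' - 1) ≤ p * (ρ * s) * (Real.exp θ' - 1) := by
                have : 0 ≤ Real.exp θ' - 1 := by linarith [Real.add_one_le_exp θ']
                have := hp.1
                gcongr
              linarith)
  have hdeg : ∀ v, H.degreeIn (F.filter fun e => ω e = true) v =
      cnt (F.filter fun e => v ∈ H.edge e) ω := by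
    intro v
    simp only [degreeIn, hcnt, Finset.filter_filter, and_comm]
  refine ⟨F.filter fun e => ω e = true, Finset.filter_subset _ _, fun v => ⟨?_, ?_⟩⟩
  · have h1 := hω (Sum.inl v)
    simp only [Sum.elim_inl] at h1
    have h2 : a < cnt (S v) ω := by
      by_contra! h
      simp [h] at h1
    rw [hdeg]
    exact h2.trans_le (Finset.card_le_card (Finset.filter_subset_filter _ (hS v)))
  · have h1 := hω (Sum.inr v)
    simp only [Sum.elim_inr] at h1
    rw [hdeg]
    by_contra! h
    simp [h] at h1

end MultiHypergraph

/-! ### The constant `c(μ)` -/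

theorem lambertW_nonneg {x : ℝ} (hx : 0 ≤ x) : 0 ≤ lambertW x := by
  have h := (lambertW_spec (x := x) (by linarith [Real.exp_pos (-1)])).2
  by_contra! hneg
  nlinarith [mul_neg_of_neg_of_pos hneg (Real.exp_pos (lambertW x))]

theorem exp_one_le_shallowConst {μ : ℝ} (hμ : 0 < μ) : Real.exp 1 ≤ shallowConst μ := by
  have := lambertW_nonneg (x := 2 / (Real.exp 1 * μ)) (by positivity)
  exact Real.exp_le_exp.mpr (by linarith)

/-- The equation `c * (log c - 1) = 2 / μ` that characterizes `c = shallowConst μ`. -/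
theorem shallowConst_mul_log {μ : ℝ} (hμ : 0 < μ) :
    shallowConst μ * (Real.log (shallowConst μ) - 1) = 2 / μ := by
  have h0 : 0 ≤ 2 / (Real.exp 1 * μ) := by positivity
  have h := (lambertW_spec (x := 2 / (Real.exp 1 * μ)) (by linarith [Real.exp_pos (-1)])).2
  rw [shallowConst, Real.log_exp, Real.exp_add, add_sub_cancel_left, mul_assoc,
    mul_comm (Real.exp (lambertW _)), h]
  field_simp

/-- The map `c ↦ c (log c - 1)` increases for `c ≥ 1` and already exceeds 2 at 4.320, whereas its
value at `shallowConst μ` is `2 / μ ≤ 2`. -/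
theorem shallowConst_lt {μ : ℝ} (hμ : 1 ≤ μ) : shallowConst μ < 4.320 := by
  have hμ0 : 0 < μ := by linarith
  by_contra! hc
  have h1 := shallowConst_mul_log hμ0
  have h2 : 2 / μ ≤ 2 := by rw [div_le_iff₀ hμ0]; linarith
  have h3 : Real.log 4.320 ≤ Real.log (shallowConst μ) := Real.log_le_log (by norm_num) hc
  have h4 : Real.log 4.320 = 2 * Real.log 2 + Real.log (1 + 0.08) := by
    rw [show (4.320 : ℝ) = 2 ^ 2 * (1 + 0.08) by norm_num, Real.log_mul (by norm_num) (by norm_num),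
      Real.log_pow]
    norm_num
  have h5 : 2 * (0.08 : ℝ) / (0.08 + 2) ≤ Real.log (1 + 0.08) :=
    Real.le_log_one_add_of_nonneg (by norm_num)
  have h6 := Real.log_two_gt_d9
  norm_num at h5
  nlinarith

theorem le_shallowConst_one : 4.319 ≤ shallowConst 1 := by
  by_contra! hc
  have hpos : 0 < shallowConst 1 := Real.exp_pos _
  have h1 := shallowConst_mul_log (μ := 1) one_pos
  have h3 : Real.log (shallowConst 1) ≤ Real.log 4.319 := Real.log_le_log hpos hc.le
  have h4 : Real.log 4.319 = 2 * Real.log 2 + Real.log 1.07975 := by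
    rw [show (4.319 : ℝ) = 2 ^ 2 * 1.07975 by norm_num, Real.log_mul (by norm_num) (by norm_num),
      Real.log_pow]
    norm_num
  have h5 : Real.log 1.07975 ≤ 0.07677 := by
    rw [Real.log_le_iff_le_exp (by norm_num)]
    refine le_trans ?_ (Real.sum_le_exp_of_nonneg (by norm_num) 4)
    norm_num [Finset.sum_range_succ, Nat.factorial]
  have h6 := Real.log_two_lt_d9
  nlinarith

/-- For `x ≥ 0` one has `0 ≤ W(x) ≤ x`, so the exponent tends to 1. -/
theorem tendsto_shallowConst : Tendsto shallowConst atTop (𝓝 (Real.exp 1)) := by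
  have h1 : Tendsto (fun μ : ℝ => 2 / (Real.exp 1 * μ)) atTop (𝓝 0) :=
    tendsto_const_nhds.div_atTop (tendsto_id.const_mul_atTop (Real.exp_pos 1))
  have h2 : Tendsto (fun μ : ℝ => lambertW (2 / (Real.exp 1 * μ))) atTop (𝓝 0) := by
    refine squeeze_zero' ?_ ?_ h1
    · filter_upwards [eventually_ge_atTop 0] with μ hμ
      exact lambertW_nonneg (by positivity)
    · filter_upwards [eventually_ge_atTop 0] with μ hμ
      have h0 : 0 ≤ 2 / (Real.exp 1 * μ) := by positivity
      have h := (lambertW_spec (x := 2 / (Real.exp 1 * μ)) (by linarith [Real.exp_pos (-1)])).2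
      have hw := lambertW_nonneg h0
      nlinarith [Real.one_le_exp hw]
  have h3 := (Real.continuous_exp.tendsto (1 + 0)).comp (h2.const_add 1)
  rw [add_zero] at h3
  exact h3

/-! ### Covers for bounded and for large `r` -/

namespace MultiHypergraph

variable {V E : Type*} [Fintype V] [Fintype E] {H : MultiHypergraph V E} {r : ℕ}

open scoped Classical in
/-- A hitting set whose degrees are optimal up to an additive constant depending on `r`. -/
theorem exists_cover_add_const (hU : H.IsUniform r) (hr : 2 ≤ r) {μ : ℝ} (hμ : 1 ≤ μ) {δ : ℕ}
    (hδ : 1 ≤ δ) (hlow : ∀ v, δ ≤ H.degree v) (hupp : ∀ v, (H.degree v : ℝ) ≤ μ * δ) :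
    ∃ M : Finset E, H.IsHitting M ∧ ∀ v, (H.degreeIn M v : ℝ) ≤
      shallowConst μ * μ * Real.log r + ((41 * r ^ 2 + 1) * (r + 2 * r ^ 2) + 41 * r) := by
  have hr2 : (2 : ℝ) ≤ r := by exact_mod_cast hr
  have hr0 : (0 : ℝ) < r := by linarith
  have hL : 0.69 ≤ Real.log r :=
    (by linarith [Real.log_two_gt_d9] : (0.69 : ℝ) ≤ Real.log 2).trans
      (Real.log_le_log (by norm_num) hr2)
  have hc : 2.7 ≤ shallowConst μ :=
    (by linarith [Real.exp_one_gt_d9] : (2.7 : ℝ) ≤ Real.exp 1).trans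
      (exp_one_le_shallowConst (by linarith))
  have hcL : 2.7 * μ * Real.log r ≤ shallowConst μ * μ * Real.log r := by gcongr
  have hμL : 0.69 * μ ≤ μ * Real.log r := by nlinarith
  -- `N = 41 r` makes the loss in the degree ratio `42 / 40 = 1.05`.
  obtain ⟨F, s, hs1, hsN, hFlow, hFupp⟩ :=
    exists_thinning hU hμ hδ hlow hupp (N := 41 * r) (by omega)
  have hκ : (((41 * r : ℕ) : ℝ) + r) / ((41 * r : ℕ) - r) = 1.05 := by
    push_cast
    field_simp
    norm_num
  rw [hκ] at hFupp
  -- If `s = 1`, all of `F` is already shallow enough; the repair step needs `s ≥ 2`.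
  rcases hs1.eq_or_lt with rfl | hs2
  · refine ⟨F, hFlow, fun v => (hFupp v).trans ?_⟩
    have : (0 : ℝ) ≤ (41 * r ^ 2 + 1) * (r + 2 * r ^ 2) + 41 * r := by positivity
    push_cast
    linarith
  have hchoose : ∀ v, ∃ S : Finset E, S ⊆ F.filter (fun e => v ∈ H.edge e) ∧ S.card = s :=
    fun v => Finset.exists_subset_card_eq (hFlow v)
  choose S hS hSs using hchoose
  have hSF : ∀ v, S v ⊆ F := fun v => (hS v).trans (Finset.filter_subset _ _)
  have hSv : ∀ v, ∀ e ∈ S v, v ∈ H.edge e := fun v e he => (Finset.mem_filter.mp (hS v he)).2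
  have hs0 : (0 : ℝ) < s := by exact_mod_cast hs1
  set L := Real.log r with hLdef
  -- The probability `p = 1 - exp (-L / s)` gives `(1 - p) ^ s = 1 / r` exactly, and `p ≤ L / s`.
  have hp : 0 ≤ 1 - Real.exp (-(L / s)) ∧ 1 - Real.exp (-(L / s)) ≤ 1 := by
    have h1 : 0 ≤ L / s := by positivity
    constructor
    · linarith [Real.exp_le_one_iff.mpr (neg_nonpos.mpr h1)]
    · linarith [Real.exp_pos (-(L / s))]
  obtain ⟨M, hM⟩ := exists_partial_cover hU hSF hSv hSs hp (γ := 21 / 20 / s) (by positivity)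
  obtain ⟨N, hNhit, hN⟩ := exists_repair hU (by omega) hSv hSs hs2 M
  refine ⟨N, hNhit, fun v => ?_⟩
  have h1 := hM v
  have h2 := hN v
  have h3 : (1 - (1 - Real.exp (-(L / s)))) ^ s = 1 / r := by
    rw [sub_sub_cancel, ← Real.exp_nat_mul, mul_neg, mul_div_cancel₀ _ hs0.ne', Real.exp_neg,
      hLdef, Real.exp_log hr0, one_div]
  have h4 : 1 - Real.exp (-(L / s)) ≤ L / s := by linarith [Real.add_one_le_exp (-(L / s))]
  have h5 : 21 / 20 / (s : ℝ) * (1 / r) * (r * H.degreeIn F v) =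
      21 / 20 / s * H.degreeIn F v := by
    field_simp
  rw [h3, h5] at h1
  have h6 : (1 - Real.exp (-(L / s))) * H.degreeIn F v + 21 / 20 / s * H.degreeIn F v ≤
      1.05 * μ * (L + 1.05) := by
    calc _ = (1 - Real.exp (-(L / s)) + 21 / 20 / s) * H.degreeIn F v := by ring
      _ ≤ (L / s + 21 / 20 / s) * (1.05 * μ * s) := by
          gcongr
          exact hFupp v
      _ = 1.05 * μ * (L + 1.05) := by
          field_simp
          ring
  have h7 : (((r * s + 1 : ℕ) : ℝ)) * (r + 21 / 20 / s * (r * (r * s))) ≤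
      (41 * r ^ 2 + 1) * (r + 2 * r ^ 2) := by
    have h8 : 21 / 20 / (s : ℝ) * (r * (r * s)) = 21 / 20 * r ^ 2 := by
      field_simp
    have h9 : (s : ℝ) ≤ 41 * r := by exact_mod_cast hsN
    have h10 : (r * s + 1 : ℝ) ≤ 41 * r ^ 2 + 1 := by nlinarith
    rw [h8]
    push_cast
    exact mul_le_mul h10 (by nlinarith [sq_nonneg (r : ℝ)]) (by positivity) (by positivity)
  -- The main terms fit because `1.05 (L + 1.05) ≤ 2.7 L` for `L ≥ 0.69`, a tight fit at `r = 2`.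
  nlinarith

/-- Thinning to degrees of order `log r`, with a factor at most `1.1` in the ratio of the
degrees. -/
theorem exists_log_thinning (hU : H.IsUniform r) (hr : 201 ≤ r) (hL : 300 ≤ Real.log r) {μ : ℝ}
    (hμ : 1 ≤ μ) {δ : ℕ} (hδ : 1 ≤ δ) (hlow : ∀ v, δ ≤ H.degree v)
    (hupp : ∀ v, (H.degree v : ℝ) ≤ μ * δ) :
    ∃ (F : Finset E) (s : ℕ), 1 ≤ s ∧ (s : ℝ) ≤ 100000 * Real.log r + 1 ∧
      (∀ v, s ≤ H.degreeIn F v) ∧ ∀ v, (H.degreeIn F v : ℝ) ≤ 1.1 * μ * s := by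
  have hr0 : (201 : ℝ) ≤ r := by exact_mod_cast hr
  -- A first, deterministic thinning to `s ≤ r²` gives `log (r s) ≤ 3 L`, which the local lemma can
  -- then handle at mean degree `100000 L`.
  obtain ⟨F, s, hs1, hsN, hFlow, hFupp⟩ :=
    exists_thinning hU hμ hδ hlow hupp (N := r ^ 2) (by nlinarith)
  have hs0 : (0 : ℝ) < s := by exact_mod_cast hs1
  have hκ : (((r ^ 2 : ℕ) : ℝ) + r) / ((r ^ 2 : ℕ) - r) ≤ 1.01 := by
    push_cast
    rw [div_le_iff₀ (by nlinarith)]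
    nlinarith
  have hFupp' : ∀ v, (H.degreeIn F v : ℝ) ≤ 1.01 * μ * s := fun v =>
    (hFupp v).trans (by gcongr)
  set L := Real.log r with hLdef
  set m : ℝ := 100000 * L with hm
  rcases le_or_gt (s : ℝ) m with h | h
  · refine ⟨F, s, hs1, by linarith, hFlow, fun v => (hFupp' v).trans ?_⟩
    gcongr
    norm_num
  have hm0 : 0 < m := by rw [hm]; linarith
  have hpm : m / s * s = m := div_mul_cancel₀ _ hs0.ne'
  have hlog : Real.log (r * s) ≤ 3 * L := by
    have h1 : Real.log s ≤ 2 * L := by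
      have : (s : ℝ) ≤ r ^ 2 := by exact_mod_cast hsN
      calc Real.log s ≤ Real.log ((r : ℝ) ^ 2) := Real.log_le_log hs0 this
        _ = 2 * L := by rw [Real.log_pow, hLdef]; norm_num
    rw [Real.log_mul (by linarith) hs0.ne']
    linarith
  have hexp1 : Real.exp (-0.04) ≤ 0.9608 := by
    rw [Real.exp_neg, inv_le_comm₀ (Real.exp_pos _) (by norm_num)]
    exact le_trans (by norm_num) (Real.quadratic_le_exp_of_nonneg (by norm_num))
  have hexp2 : Real.exp 0.04 ≤ 1.0417 := by
    rw [← inv_inv (Real.exp 0.04), ← Real.exp_neg]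
    have := Real.add_one_le_exp (-0.04)
    rw [inv_le_comm₀ (Real.exp_pos _) (by norm_num)]
    exact le_trans (by norm_num) this
  have hfl : (⌊0.97 * m⌋₊ : ℝ) ≤ 0.97 * m := Nat.floor_le (by positivity)
  have hfl' : 0.97 * m < ⌊0.97 * m⌋₊ + 1 := Nat.lt_floor_add_one _
  -- Deviations of 3% below and 5% above leave a ratio `1.05 * 1.01 / 0.97 < 1.1`. The factor 100000
  -- in `m` makes the small Chernoff gains at `θ = 0.04` exceed `3 L` plus the constants.
  obtain ⟨M, -, hM⟩ := exists_sample hU (by omega) hs1 hFlow hFupp' (p := m / s) (θ := 0.04)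
    (θ' := 0.04) (t := 1.05 * (1.01 * μ) * m) (a := ⌊0.97 * m⌋₊)
    ⟨by positivity, by rw [div_le_one hs0]; exact h.le⟩ (by norm_num) (by norm_num)
    (by rw [hpm]; nlinarith)
    (by
      have h1 : m / s * (1.01 * μ * s) = 1.01 * μ * m := by rw [← hpm]; ring_nf; field_simp
      rw [h1]
      have h2 : 1.01 * μ * m * (Real.exp 0.04 - 1) ≤ 1.01 * μ * m * 0.0417 := by
        gcongr
        linarith
      have h3 : 300 * μ ≤ L * μ := by gcongr
      have h4 : L ≤ L * μ := le_mul_of_one_le_right (by linarith) hμ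
      have h5 : 1.01 * μ * m = 101000 * (L * μ) := by rw [hm]; ring
      nlinarith)
  refine ⟨M, ⌊0.97 * m⌋₊ + 1, by omega, by push_cast; linarith, fun v => (hM v).1,
    fun v => (hM v).2.le.trans ?_⟩
  push_cast
  have : μ * (0.97 * m) ≤ μ * (⌊0.97 * m⌋₊ + 1) := by gcongr
  nlinarith [mul_pos (by linarith : 0 < μ) hm0]

/-- After thinning, `s` is of order at most `log r`, so `log (r s) ≤ 1.08 log r`. Sampling at mean
`1.1 log r` then leaves room in both tails of the local lemma. -/
theorem exists_cover_of_large (hU : H.IsUniform r) (hr : 201 ≤ r) (hL : 300 ≤ Real.log r)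
    (hlog : Real.log (100000 * Real.log r + 1) ≤ 0.08 * Real.log r) {μ : ℝ}
    (hμ : 1 ≤ μ) {δ : ℕ} (hδ : 1 ≤ δ) (hlow : ∀ v, δ ≤ H.degree v)
    (hupp : ∀ v, (H.degree v : ℝ) ≤ μ * δ) :
    ∃ M : Finset E, H.IsHitting M ∧
      ∀ v, (H.degreeIn M v : ℝ) ≤ shallowConst μ * μ * Real.log r := by
  obtain ⟨F, s, hs1, hsN, hFlow, hFupp⟩ := exists_log_thinning hU hr hL hμ hδ hlow hupp
  have hs0 : (0 : ℝ) < s := by exact_mod_cast hs1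
  have hμ0 : 0 < μ := by linarith
  have hr0 : (0 : ℝ) < r := by exact_mod_cast (by omega : 0 < r)
  set L := Real.log r with hLdef
  have hL0 : 0 < L := by linarith
  set c := shallowConst μ with hcdef
  have hc1 : 2.7 ≤ c :=
    (by linarith [Real.exp_one_gt_d9] : (2.7 : ℝ) ≤ Real.exp 1).trans (exp_one_le_shallowConst hμ0)
  have hc2 : c < 4.320 := shallowConst_lt hμ
  have hc0 : 0 < c := by linarith
  have hceq : c * (Real.log c - 1) = 2 / μ := shallowConst_mul_log hμ0
  have hμL : 0 < μ * L := by positivity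
  rcases lt_or_ge (s : ℝ) (1.1 * L) with h | h
  · refine ⟨F, fun v => hs1.trans (hFlow v), fun v => (hFupp v).trans ?_⟩
    calc 1.1 * μ * s ≤ 1.1 * μ * (1.1 * L) := by gcongr
      _ = 1.21 * (μ * L) := by ring
      _ ≤ c * (μ * L) := by gcongr; linarith
      _ = c * μ * L := by ring
  have hpm : 1.1 * L / s * s = 1.1 * L := div_mul_cancel₀ _ hs0.ne'
  have hlogs : Real.log (r * s) ≤ 1.08 * L := by
    rw [Real.log_mul hr0.ne' hs0.ne']
    have := Real.log_le_log hs0 hsN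
    linarith
  have hlogc : 1 ≤ Real.log c := by
    by_contra! hneg
    have : c * (Real.log c - 1) < 0 := mul_neg_of_pos_of_neg hc0 (by linarith)
    have : 0 < 2 / μ := by positivity
    linarith
  -- With `a = 0` a huge `θ` costs nothing. The mean degree is at most `1.21 μ L`, so Chernoff's
  -- optimal parameter for `t = c μ L` is `log (c / 1.21)`, roughly `log c - 0.2`.
  obtain ⟨M, -, hM⟩ := exists_sample hU (by omega) hs1 hFlow hFupp (p := 1.1 * L / s) (θ := 1000)
    (θ' := Real.log c - 0.2) (t := c * μ * L) (a := 0)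
    ⟨by positivity, by rw [div_le_one hs0]; exact h⟩ (by norm_num) (by linarith)
    (by
      have h1 : Real.exp (-1000) ≤ 0.001 := by
        rw [Real.exp_neg, inv_le_comm₀ (Real.exp_pos _) (by norm_num)]
        exact le_trans (by norm_num) (Real.add_one_le_exp _)
      rw [hpm]
      push_cast
      nlinarith)
    (by
      have h1 : 1.1 * L / s * (1.1 * μ * s) = 1.21 * (μ * L) := by
        field_simp
        norm_num
      have h2 : Real.exp (Real.log c - 0.2) ≤ c / 1.21 := by
        rw [Real.exp_sub, Real.exp_log hc0]
        gcongr
        exact le_trans (by norm_num) (Real.quadratic_le_exp_of_nonneg (by norm_num))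
      have h3 : 1.21 * (μ * L) * (Real.exp (Real.log c - 0.2) - 1) ≤
          1.21 * (μ * L) * (c / 1.21 - 1) := by gcongr
      have h4 : (Real.log c - 0.2) * (c * μ * L) = 2 * L + 0.8 * c * (μ * L) := by
        have : c * Real.log c * μ = c * μ + 2 := by
          have : c * Real.log c = c + 2 / μ := by linarith
          rw [this]
          field_simp
        linear_combination L * this
      have h5 : 300 * μ ≤ μ * L := by rw [mul_comm]; gcongr
      have h6 : c * (μ * L) ≤ 4.32 * (μ * L) :=
        mul_le_mul_of_nonneg_right (hc2.le.trans (by norm_num)) hμL.le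
      have h7 : 1.21 * (μ * L) * (c / 1.21 - 1) = c * (μ * L) - 1.21 * (μ * L) := by ring
      rw [h1, h4]
      linarith)
  exact ⟨M, fun v => (hM v).1, fun v => (hM v).2.le⟩

end MultiHypergraph

/-! ### Degree bounds from near-regularity -/

namespace MultiHypergraph

variable {V E : Type*} [Fintype E] {H : MultiHypergraph V E}

theorem minDegree_le_degree (v : V) : H.minDegree ≤ H.degree v :=
  ciInf_le (OrderBot.bddBelow _) v

theorem degree_le_maxDegree [Fintype V] (v : V) : H.degree v ≤ H.maxDegree :=
  Finset.le_sup (Finset.mem_univ v)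

theorem nonempty_of_minDegree_pos (h : 0 < H.minDegree) : Nonempty V := by
  by_contra hV
  rw [not_nonempty_iff] at hV
  simp [minDegree] at h

theorem IsNearRegular.degree_le [Fintype V] {μ : ℝ} (h : H.IsNearRegular μ) (v : V) :
    (H.degree v : ℝ) ≤ μ * H.minDegree := by
  have h0 : (0 : ℝ) < H.minDegree := by exact_mod_cast h.1
  refine le_trans ?_ ((div_le_iff₀ h0).mp h.2)
  exact_mod_cast degree_le_maxDegree v

theorem IsNearRegular.one_le [Fintype V] {μ : ℝ} (h : H.IsNearRegular μ) : 1 ≤ μ := by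
  obtain ⟨v⟩ := nonempty_of_minDegree_pos h.1
  have h0 : (0 : ℝ) < H.minDegree := by exact_mod_cast h.1
  have h1 : (H.minDegree : ℝ) ≤ H.degree v := by exact_mod_cast minDegree_le_degree v
  have h2 := h.degree_le v
  by_contra! hμ
  nlinarith

theorem IsRegular.isNearRegular_one [Fintype V] (h : H.IsRegular) (hpos : 0 < H.minDegree) :
    H.IsNearRegular 1 := by
  refine ⟨hpos, ?_⟩
  have h0 : (0 : ℝ) < H.minDegree := by exact_mod_cast hpos
  rw [IsRegular] at h
  rw [h, div_self h0.ne']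

end MultiHypergraph

/-! ### The uniform bound and its relative error -/

theorem exists_forall_ge_log_large : ∃ R : ℕ, ∀ r ≥ R, 201 ≤ r ∧ 300 ≤ Real.log r ∧
    Real.log (100000 * Real.log r + 1) ≤ 0.08 * Real.log r := by
  have hlog : Tendsto (fun r : ℕ => Real.log r) atTop atTop :=
    Real.tendsto_log_atTop.comp tendsto_natCast_atTop_atTop
  have h1 : Tendsto (fun x : ℝ => 100000 * x + 1) atTop atTop :=
    tendsto_atTop_add_const_right _ _ (tendsto_id.const_mul_atTop (by norm_num))
  have h2 : ∀ᶠ y : ℝ in atTop, Real.log y ≤ 0.0000001 * y := by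
    filter_upwards [Real.isLittleO_log_id_atTop.bound (by norm_num : (0 : ℝ) < 0.0000001),
      eventually_ge_atTop 0] with y hy hy0
    rw [id, Real.norm_of_nonneg hy0] at hy
    exact (le_abs_self _).trans hy
  obtain ⟨R, hR⟩ := eventually_atTop.mp ((eventually_ge_atTop 201).and
    ((hlog.eventually_ge_atTop 300).and (hlog.eventually (h1.eventually h2))))
  refine ⟨R, fun r hr => ⟨(hR r hr).1, (hR r hr).2.1, ?_⟩⟩
  linarith [(hR r hr).2.1, (hR r hr).2.2]

/-- The additive constant `C` is uniform in `μ`, `r` and the hypergraph. -/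
theorem exists_uniform_cover_bound : ∃ C : ℕ, ∀ (μ : ℝ) (r : ℕ), 2 ≤ r →
    ∀ (V : Type*) (E : Type*) [Fintype V] [Fintype E] (H : MultiHypergraph V E),
      H.IsUniform r → H.IsNearRegular μ →
        ∃ M : Finset E, H.IsHitting M ∧
          ∀ v, (H.degreeIn M v : ℝ) ≤ shallowConst μ * μ * Real.log r + C := by
  obtain ⟨R, hR⟩ := exists_forall_ge_log_large
  refine ⟨(41 * R ^ 2 + 1) * (R + 2 * R ^ 2) + 41 * R, fun μ r hr V E _ _ H hU hμ => ?_⟩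
  have hδ : 1 ≤ H.minDegree := hμ.1
  rcases le_or_gt R r with h | h
  · obtain ⟨h1, h2, h3⟩ := hR r h
    obtain ⟨M, hM, hdeg⟩ := MultiHypergraph.exists_cover_of_large hU h1 h2 h3 hμ.one_le hδ
      MultiHypergraph.minDegree_le_degree hμ.degree_le
    exact ⟨M, hM, fun v => (hdeg v).trans (le_add_of_nonneg_right (Nat.cast_nonneg _))⟩
  · obtain ⟨M, hM, hdeg⟩ := MultiHypergraph.exists_cover_add_const hU hr hμ.one_le hδ
      MultiHypergraph.minDegree_le_degree hμ.degree_le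
    refine ⟨M, hM, fun v => (hdeg v).trans ?_⟩
    have hrR : (r : ℝ) ≤ R := by exact_mod_cast h.le
    push_cast
    gcongr

/-- The relative error of `⌈c * μ * log r⌉ + C` as an approximation of `c * μ * log r`. -/
noncomputable def shallowError (C : ℕ) (μ : ℝ) (r : ℕ) : ℝ :=
  -- The value 0 elsewhere matters: nonnegativity and the limit are required for all pairs,
  -- including those with `μ < 1` or `r < 2`.
  if 1 ≤ μ ∧ 2 ≤ r then
    ((⌈shallowConst μ * μ * Real.log r⌉₊ + C : ℕ) : ℝ) / (shallowConst μ * μ * Real.log r) - 1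
  else 0

section ShallowError

variable {μ : ℝ} {r : ℕ}

theorem le_shallowConst_mul_mul_log (hμ : 1 ≤ μ) (hr : 2 ≤ r) :
    μ * Real.log r ≤ shallowConst μ * μ * Real.log r ∧ 0.69 * μ ≤ μ * Real.log r := by
  have hL : 0.69 ≤ Real.log r :=
    (by linarith [Real.log_two_gt_d9] : (0.69 : ℝ) ≤ Real.log 2).trans
      (Real.log_le_log (by norm_num) (by exact_mod_cast hr))
  have hc : 1 ≤ shallowConst μ :=
    (Real.one_le_exp zero_le_one).trans (exp_one_le_shallowConst (by linarith))
  refine ⟨?_, by nlinarith⟩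
  rw [mul_assoc]
  exact le_mul_of_one_le_left (by nlinarith) hc

theorem shallowError_spec (C : ℕ) (hμ : 1 ≤ μ) (hr : 2 ≤ r) :
    ((⌈shallowConst μ * μ * Real.log r⌉₊ + C : ℕ) : ℝ) =
      shallowConst μ * μ * Real.log r * (1 + shallowError C μ r) := by
  have h := le_shallowConst_mul_mul_log hμ hr
  have h0 : shallowConst μ * μ * Real.log r ≠ 0 := by linarith
  rw [shallowError, if_pos ⟨hμ, hr⟩, add_sub_cancel, mul_div_cancel₀ _ h0]

theorem shallowError_nonneg (C : ℕ) (μ : ℝ) (r : ℕ) : 0 ≤ shallowError C μ r := by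
  rw [shallowError]
  split_ifs with hr
  · have h := le_shallowConst_mul_mul_log hr.1 hr.2
    rw [sub_nonneg, one_le_div (by linarith)]
    push_cast
    linarith [Nat.le_ceil (shallowConst μ * μ * Real.log r), (Nat.cast_nonneg C : (0 : ℝ) ≤ C)]
  · exact le_rfl

theorem ceil_add_le (C : ℕ) (hμ : 1 ≤ μ) (hr : 2 ≤ r) :
    ((⌈shallowConst μ * μ * Real.log r⌉₊ + C : ℕ) : ℝ) ≤
      shallowConst μ * μ * Real.log r + (C + 1) := by
  have h := le_shallowConst_mul_mul_log hμ hr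
  push_cast
  linarith [Nat.ceil_lt_add_one
    (by linarith : 0 ≤ shallowConst μ * μ * Real.log r)]

theorem ceil_add_le_mul (C : ℕ) (hμ : 1 ≤ μ) (hr : 2 ≤ r) :
    ((⌈shallowConst μ * μ * Real.log r⌉₊ + C : ℕ) : ℝ) ≤
      (4.32 + 2 * (C + 1)) * (μ * Real.log r) := by
  have h := le_shallowConst_mul_mul_log hμ hr
  have h1 : shallowConst μ * (μ * Real.log r) ≤ 4.32 * (μ * Real.log r) :=
    mul_le_mul_of_nonneg_right ((shallowConst_lt hμ).le.trans (by norm_num)) (by linarith)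
  have h2 : ((C : ℝ) + 1) * 1 ≤ (C + 1) * (2 * (μ * Real.log r)) := by
    gcongr
    linarith
  linarith [ceil_add_le C hμ hr]

/-- The absolute error is at most `C + 1`, and `log (μ r) = log μ + log r` is at most `3 c μ log r`,
because `log μ ≤ μ` and `log r ≥ 0.69`. -/
theorem shallowError_le (C : ℕ) (h1 : 1 < μ * r) :
    shallowError C μ r ≤ 3 * (C + 1) / Real.log (μ * r) := by
  have hlog : 0 < Real.log (μ * r) := Real.log_pos h1
  rw [shallowError]
  split_ifs with hr
  · obtain ⟨hμ, hr⟩ := hr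
    have h := le_shallowConst_mul_mul_log hμ hr
    have hc0 : 0 < shallowConst μ * μ * Real.log r := by linarith
    have hr0 : (0 : ℝ) < r := by exact_mod_cast (by omega : 0 < r)
    have h2 : Real.log (μ * r) ≤ 3 * (shallowConst μ * μ * Real.log r) := by
      rw [Real.log_mul (by linarith) hr0.ne']
      have h3 := Real.log_le_sub_one_of_pos (by linarith : 0 < μ)
      have h4 : Real.log r ≤ μ * Real.log r :=
        le_mul_of_one_le_left (Real.log_natCast_nonneg r) hμ
      linarith
    rw [sub_le_iff_le_add, div_le_iff₀ hc0, add_mul, one_mul, div_mul_eq_mul_div]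
    have h5 : (C : ℝ) + 1 ≤ 3 * (C + 1) * (shallowConst μ * μ * Real.log r) / Real.log (μ * r) := by
      rw [le_div_iff₀ hlog]
      nlinarith [(Nat.cast_nonneg C : (0 : ℝ) ≤ C)]
    linarith [ceil_add_le C hμ hr]
  · positivity

theorem isLittleOMuR_shallowError (C : ℕ) : IsLittleOMuR (shallowError C) := by
  refine ⟨shallowError_nonneg C, ?_⟩
  have hmul : Tendsto (fun p : ℝ × ℕ => p.1 * (p.2 : ℝ))
      (comap (fun p : ℝ × ℕ => p.1 * (p.2 : ℝ)) atTop) atTop := tendsto_comap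
  have hlim : Tendsto (fun p : ℝ × ℕ => 3 * ((C : ℝ) + 1) / Real.log (p.1 * p.2))
      (comap (fun p : ℝ × ℕ => p.1 * (p.2 : ℝ)) atTop) (𝓝 0) :=
    tendsto_const_nhds.div_atTop (Real.tendsto_log_atTop.comp hmul)
  refine squeeze_zero' (Eventually.of_forall fun p => shallowError_nonneg C p.1 p.2) ?_ hlim
  filter_upwards [hmul.eventually_gt_atTop 1] with p hp
  exact shallowError_le C hp

end ShallowError

theorem IsLittleOMuR.isLittleOR_one {f : ℝ → ℕ → ℝ} (hf : IsLittleOMuR f) : IsLittleOR (f 1) := by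
  refine ⟨hf.1 1, hf.2.comp (g := fun p : ℝ × ℕ => f p.1 p.2) (f := fun r : ℕ => ((1 : ℝ), r)) ?_⟩
  rw [tendsto_comap_iff]
  simpa [Function.comp_def] using tendsto_natCast_atTop_atTop (R := ℝ)

/-! ### The theorem and its corollary -/

theorem mainTheorem5 :
    -- near-regular hypergraphs
    (∃ (t : ℝ → ℕ → ℕ) (f : ℝ → ℕ → ℝ),
      IsLittleOMuR f ∧
      (∀ (μ : ℝ) (r : ℕ), 1 ≤ μ → 2 ≤ r →
        (t μ r : ℝ) = shallowConst μ * μ * Real.log r * (1 + f μ r)) ∧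
      (∃ C : ℝ, ∀ (μ : ℝ) (r : ℕ), 1 ≤ μ → 2 ≤ r → (t μ r : ℝ) ≤ C * (μ * Real.log r)) ∧
      (∀ (μ : ℝ) (r : ℕ), 2 ≤ r →
        ∀ (V E : Type*) [Fintype V] [Fintype E] (H : MultiHypergraph V E),
          H.IsUniform r → H.IsNearRegular μ → 4 ≤ H.girth →
            ∃ M : Finset E, H.IsHitting M ∧ H.IsShallow (t μ r) M)) ∧
    Tendsto shallowConst atTop (𝓝 (Real.exp 1)) ∧
    -- regular hypergraphs
    (∃ (t : ℕ → ℕ) (f : ℕ → ℝ),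
      IsLittleOR f ∧
      (∀ r : ℕ, 2 ≤ r →
        (t r : ℝ) = Real.exp (1 + lambertW (2 / Real.exp 1)) * Real.log r * (1 + f r)) ∧
      (∃ C : ℝ, ∀ r : ℕ, 2 ≤ r → (t r : ℝ) ≤ C * Real.log r) ∧
      (∀ r : ℕ, 2 ≤ r →
        ∀ (V E : Type*) [Fintype V] [Fintype E] (H : MultiHypergraph V E),
          H.IsUniform r → H.IsRegular → 0 < H.minDegree → 4 ≤ H.girth →
            ∃ M : Finset E, H.IsHitting M ∧ H.IsShallow (t r) M)) ∧
    (4.319 ≤ Real.exp (1 + lambertW (2 / Real.exp 1)) ∧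
      Real.exp (1 + lambertW (2 / Real.exp 1)) < 4.320) := by
  have hone : shallowConst 1 = Real.exp (1 + lambertW (2 / Real.exp 1)) := by
    rw [shallowConst, mul_one]
  rw [← hone]
  obtain ⟨C, hC⟩ := exists_uniform_cover_bound
  -- A second instance is taken because the two halves quantify over types in independent universes.
  obtain ⟨D, hD⟩ := exists_uniform_cover_bound
  refine ⟨⟨fun μ r => ⌈shallowConst μ * μ * Real.log r⌉₊ + C, shallowError C,
    isLittleOMuR_shallowError C, fun μ r hμ hr => shallowError_spec C hμ hr,
    ⟨_, fun μ r hμ hr => ceil_add_le_mul C hμ hr⟩, fun μ r hr V E _ _ H hU hH _ => ?_⟩,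
    tendsto_shallowConst,
    ⟨fun r => ⌈shallowConst 1 * 1 * Real.log r⌉₊ + D, shallowError D 1,
      (isLittleOMuR_shallowError D).isLittleOR_one, fun r hr => ?_,
      ⟨4.32 + 2 * (D + 1), fun r hr => ?_⟩, fun r hr V E _ _ H hU hreg hpos _ => ?_⟩,
    le_shallowConst_one, shallowConst_lt le_rfl⟩
  · obtain ⟨M, hM, hdeg⟩ := hC μ r hr V E H hU hH
    refine ⟨M, hM, fun v => ?_⟩
    have h := (hdeg v).trans (add_le_add_left (Nat.le_ceil _) _)
    exact_mod_cast h
  · simpa using shallowError_spec D le_rfl hr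
  · simpa using ceil_add_le_mul D le_rfl hr
  · obtain ⟨M, hM, hdeg⟩ := hD 1 r hr V E H hU (hreg.isNearRegular_one hpos)
    refine ⟨M, hM, fun v => ?_⟩
    have h := (hdeg v).trans (add_le_add_left (Nat.le_ceil _) _)
    exact_mod_cast h
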